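/- Let $d\ge 1$ and $n\ge 3$ be integers and let $u\in\mathbb{C}$, $u\neq 0$. For $m\ge 0$ let ${\rm Y}_{d,m}(u)$ be the Yokonuma--Hecke algebra: the unital associative $\mathbb{C}$-algebra generated by $g_1,\dots,g_{m-1},t_1,\dots,t_m$ with relations $g_ig_j=g_jg_i$ for $|i-j|>1$, $g_{i+1}g_ig_{i+1}=g_ig_{i+1}g_i$, $t_it_j=t_jt_i$, $t_i^d=1$, $g_it_i=t_{i+1}g_i$, $g_it_{i+1}=t_ig_i$, $g_it_j=t_jg_i$ for $j\ne i,i+1$, and $g_i^2=1+(u-1)e_i+(u-1)e_ig_i$, where $e_i=e_i^{(0)}$ and $$e_i^{(k)}=\frac1d\sum_{s=0}^{d-1}t_i^{k+s}t_{i+1}^{d-s}\qquad(0\le k\le d-1).$$ For $1\le i\le n-2$ put $$c_{i,i+1}=\sum_{p,q,r=0}^{d-1}t_i^pt_{i+1}^qt_{i+2}^r\,\bigl(1+g_i+g_{i+1}+g_ig_{i+1}+g_{i+1}g_i+g_ig_{i+1}g_i\bigr)\in{\rm Y}_{d,n}(u),$$ and let ${\rm CTL}_{d,n}(u)$, the Complex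 Reflection Temperley--Lieb algebra, be the quotient of ${\rm Y}_{d,n}(u)$ by the two-sided ideal generated by $c_{1,2},\dots,c_{n-2,n-1}$. Let $z\in\mathbb{C}$ and let $x:\mathbb{Z}/d\mathbb{Z}\to\mathbb{C}$, $k\mapsto x_k$, satisfy $x_0=1$. A Markov trace with parameters $z,x_1,\dots,x_{d-1}$ is a family of linear maps ${\rm tr}:{\rm Y}_{d,m}(u)\to\mathbb{C}$ $(m\ge0)$, compatible with the natural maps ${\rm Y}_{d,m}(u)\to{\rm Y}_{d,m+1}(u)$, such that ${\rm tr}(1)=1$, ${\rm tr}(ab)={\rm tr}(ba)$, ${\rm tr}(ag_m)=z\,{\rm tr}(a)$ for $a\in{\rm Y}_{d,m}(u)$, $m\ge1$, and ${\rm tr}(at_{m+1}^s)=x_s\,{\rm tr}(a)$ for $a\in{\rm Y}_{d,m}(u)$, $m\ge 0$, $1\le s\le d-1$. Put $E^{(k)}=\frac1d\sum_{s\in\mathbb{Z}/d\mathbb{Z}}x_{k+s}x_{-s}$. The $x_k$ satisfy the E-condition if $E^{(k)}=x_kE^{(0)}$ for $1\le k\le d-1$. Then: (1) For all such $z$ and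 $x$ there is exactly one Markov trace ${\rm tr}$ with parameters $z,x_1,\dots,x_{d-1}$, and its restriction to ${\rm Y}_{d,n}(u)$ passes to (that is, factors through) the quotient ${\rm CTL}_{d,n}(u)$ if and only if $$(u+1)z^2\sum_{k\in\mathbb{Z}/d\mathbb{Z}}x_k+(u+2)z\sum_{k\in\mathbb{Z}/d\mathbb{Z}}E^{(k)}+\sum_{k\in\mathbb{Z}/d\mathbb{Z}}{\rm tr}\bigl(e_1^{(k)}e_2\bigr)=0 .$$ (2) Passing to ${\rm CTL}_{d,n}(u)$ does not force the E-condition: if $d\ge2$, there are parameters $z,x_1,\dots,x_{d-1}$ for which ${\rm tr}$ passes to ${\rm CTL}_{d,n}(u)$ although the $x_k$ do not satisfy the E-condition. -/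

import Mathlib

noncomputable section

namespace YokonumaHecke

/-- Generators of the Yokonuma-Hecke algebra on `n` strands. Strands are numbered `0, …, n - 1`:
`g i` is the braiding generator of the strands `i, i + 1`, and `t j` is the framing generator
of the strand `j`. -/
inductive Gen (n : ℕ) : Type
  | g (i : ℕ) (hi : i + 1 < n) : Gen n
  | t (j : ℕ) (hj : j < n) : Gen n

/-- `(1/d) ∑_{s=0}^{d-1} a^{m+s} b^{d-s}`. For `a = t_i`, `b = t_{i+1}` this is `e_i^{(m)}`. -/
def framingAverage (d : ℕ) {A : Type*} [Ring A] [Algebra ℂ A] (m : ℕ) (a b : A) : A :=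
  ((1 : ℂ) / (d : ℂ)) • ∑ s ∈ Finset.range d, a ^ (m + s) * b ^ (d - s)

/-- The generator `g_i` in the free algebra. -/
def freeG {n : ℕ} (i : ℕ) (hi : i + 1 < n) : FreeAlgebra ℂ (Gen n) :=
  FreeAlgebra.ι ℂ (Gen.g i hi)

/-- The generator `t_j` in the free algebra. -/
def freeT {n : ℕ} (j : ℕ) (hj : j < n) : FreeAlgebra ℂ (Gen n) :=
  FreeAlgebra.ι ℂ (Gen.t j hj)

/-- The defining relations of the Yokonuma-Hecke algebra. -/
inductive Rel (d n : ℕ) (u : ℂ) : FreeAlgebra ℂ (Gen n) → FreeAlgebra ℂ (Gen n) → Prop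
  | g_comm (i j : ℕ) (hi : i + 1 < n) (hj : j + 1 < n) (hij : i + 1 < j ∨ j + 1 < i) :
      Rel d n u (freeG i hi * freeG j hj) (freeG j hj * freeG i hi)
  | braid (i : ℕ) (hi : i + 1 < n) (hi' : i + 1 + 1 < n) :
      Rel d n u (freeG (i + 1) hi' * freeG i hi * freeG (i + 1) hi')
        (freeG i hi * freeG (i + 1) hi' * freeG i hi)
  | t_comm (i j : ℕ) (hi : i < n) (hj : j < n) :
      Rel d n u (freeT i hi * freeT j hj) (freeT j hj * freeT i hi)
  | t_pow (i : ℕ) (hi : i < n) : Rel d n u (freeT i hi ^ d) 1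
  | g_t_left (i : ℕ) (hi : i + 1 < n) (hi' : i < n) :
      Rel d n u (freeG i hi * freeT i hi') (freeT (i + 1) hi * freeG i hi)
  | g_t_right (i : ℕ) (hi : i + 1 < n) (hi' : i < n) :
      Rel d n u (freeG i hi * freeT (i + 1) hi) (freeT i hi' * freeG i hi)
  | g_t_comm (i j : ℕ) (hi : i + 1 < n) (hj : j < n) (h1 : j ≠ i) (h2 : j ≠ i + 1) :
      Rel d n u (freeG i hi * freeT j hj) (freeT j hj * freeG i hi)
  | quadratic (i : ℕ) (hi : i + 1 < n) (hi' : i < n) :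
      Rel d n u (freeG i hi ^ 2)
        (1 + (u - 1) • framingAverage d 0 (freeT i hi') (freeT (i + 1) hi)
          + (u - 1) • (framingAverage d 0 (freeT i hi') (freeT (i + 1) hi) * freeG i hi))

/-- The Yokonuma-Hecke algebra `Y_{d,n}(u)`, presented by generators and relations. -/
abbrev Y (d n : ℕ) (u : ℂ) : Type := RingQuot (Rel d n u)

section Elements

variable {d n : ℕ} {u : ℂ}

/-- The generator `g_i` of `Y_{d,n}(u)`. -/
def g (i : ℕ) (hi : i + 1 < n) : Y d n u := RingQuot.mkAlgHom ℂ (Rel d n u) (freeG i hi)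

/-- The generator `t_j` of `Y_{d,n}(u)`. -/
def t (j : ℕ) (hj : j < n) : Y d n u := RingQuot.mkAlgHom ℂ (Rel d n u) (freeT j hj)

/-- The element `e_i^{(m)}` of `Y_{d,n}(u)`, the shift of `e_i` by `m`. -/
def e (m i : ℕ) (hi : i + 1 < n) : Y d n u :=
  framingAverage d m (t i (Nat.lt_of_succ_lt hi)) (t (i + 1) hi)

/-- The sum of the `g_w` over the six elements `w` of `⟨s_i, s_{i+1}⟩`, written through their
reduced words `1, s_i, s_{i+1}, s_i s_{i+1}, s_{i+1} s_i, s_i s_{i+1} s_i`. -/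
def steinberg (i : ℕ) (hi : i + 2 < n) : Y d n u :=
  let a : Y d n u := g i (Nat.lt_of_succ_lt hi)
  let b : Y d n u := g (i + 1) hi
  1 + a + b + a * b + b * a + a * b * a

/-- The sum of the `g_c` over the subgroup
`⟨t_i, t_{i+1}, t_{i+2}⟩ ⋊ ⟨s_i, s_{i+1}⟩` of `C_d^n ⋊ S_n`, where
`g_c = t_i^p t_{i+1}^q t_{i+2}^r g_w` for `c = t_i^p t_{i+1}^q t_{i+2}^r w`. -/
def cElem (i : ℕ) (hi : i + 2 < n) : Y d n u :=
  ∑ p ∈ Finset.range d, ∑ q ∈ Finset.range d, ∑ r ∈ Finset.range d,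
    t i (Nat.lt_of_succ_lt (Nat.lt_of_succ_lt hi)) ^ p *
      t (i + 1) (Nat.lt_of_succ_lt hi) ^ q * t (i + 2) hi ^ r * steinberg i hi

end Elements

theorem map_framingAverage (d : ℕ) {A B : Type*} [Ring A] [Algebra ℂ A] [Ring B] [Algebra ℂ B]
    (f : A →ₐ[ℂ] B) (m : ℕ) (a b : A) :
    f (framingAverage d m a b) = framingAverage d m (f a) (f b) := by
  simp [framingAverage, map_sum]

/-- Images of the generators under the natural map `Y_{d,n}(u) → Y_{d,n+1}(u)`. -/
def inclGen (d n : ℕ) (u : ℂ) : Gen n → Y d (n + 1) u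
  | Gen.g i hi => g i (Nat.lt_succ_of_lt hi)
  | Gen.t j hj => t j (Nat.lt_succ_of_lt hj)

theorem inclGen_rel (d n : ℕ) (u : ℂ) ⦃a b : FreeAlgebra ℂ (Gen n)⦄ (h : Rel d n u a b) :
    FreeAlgebra.lift ℂ (inclGen d n u) a = FreeAlgebra.lift ℂ (inclGen d n u) b := by
  have hg : ∀ i (hi : i + 1 < n), FreeAlgebra.lift ℂ (inclGen d n u) (freeG i hi)
      = RingQuot.mkAlgHom ℂ (Rel d (n + 1) u) (freeG i (Nat.lt_succ_of_lt hi)) := by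
    intro i hi; simp [freeG, inclGen, g]
  have ht : ∀ i (hi : i < n), FreeAlgebra.lift ℂ (inclGen d n u) (freeT i hi)
      = RingQuot.mkAlgHom ℂ (Rel d (n + 1) u) (freeT i (Nat.lt_succ_of_lt hi)) := by
    intro i hi; simp [freeT, inclGen, t]
  induction h <;>
    simp only [map_mul, map_pow, map_add, map_one, map_smul, map_framingAverage, hg, ht] <;>
    simp only [← map_mul, ← map_pow, ← map_add, ← map_smul, ← map_framingAverage,
      ← map_one (RingQuot.mkAlgHom ℂ (Rel d (n + 1) u))] <;>
    apply RingQuot.mkAlgHom_rel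
  case g_comm hij => exact Rel.g_comm _ _ _ _ hij
  case braid => exact Rel.braid _ _ _
  case t_comm => exact Rel.t_comm _ _ _ _
  case t_pow => exact Rel.t_pow _ _
  case g_t_left => exact Rel.g_t_left _ _ _
  case g_t_right => exact Rel.g_t_right _ _ _
  case g_t_comm h1 h2 => exact Rel.g_t_comm _ _ _ _ h1 h2
  case quadratic => exact Rel.quadratic _ _ _

/-- The natural algebra map `Y_{d,n}(u) → Y_{d,n+1}(u)`, `g_i ↦ g_i`, `t_j ↦ t_j`. -/
def incl (d n : ℕ) (u : ℂ) : Y d n u →ₐ[ℂ] Y d (n + 1) u :=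
  RingQuot.liftAlgHom ℂ ⟨FreeAlgebra.lift ℂ (inclGen d n u), inclGen_rel d n u⟩

/-- `tr` is a Markov trace with parameters `z` and `x` on the tower of the algebras
`Y_{d,n}(u)`. A linear functional on the union of the tower is a family of functionals that is
compatible with the natural maps. In `tr_g` and `tr_t` the generator is the last one of the
larger algebra. (The functional on `Y_{d,0}(u) = ℂ`, and `tr_t` for `n = 0`, only add
`tr (t_0 ^ s) = x_s`, which for `u ≠ 0` also follows from the other rules.) -/
structure IsMarkovTrace (d : ℕ) (u z : ℂ) (x : ZMod d → ℂ)
    (tr : ∀ n : ℕ, Y d n u →ₗ[ℂ] ℂ) : Prop where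
  compat : ∀ (n : ℕ) (a : Y d n u), tr (n + 1) (incl d n u a) = tr n a
  mul_comm : ∀ (n : ℕ) (a b : Y d n u), tr n (a * b) = tr n (b * a)
  one : ∀ n : ℕ, tr n 1 = 1
  tr_g : ∀ (n : ℕ) (a : Y d (n + 1) u),
    tr (n + 2) (incl d (n + 1) u a * g n (Nat.lt_succ_self (n + 1))) = z * tr (n + 1) a
  tr_t : ∀ (n : ℕ) (a : Y d n u) (s : ℕ), 1 ≤ s → s < d →
    tr (n + 1) (incl d n u a * t n (Nat.lt_succ_self n) ^ s) = x (s : ZMod d) * tr n a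

/-- The two-sided ideal of `Y_{d,n}(u)` generated by all the elements `c_{i,i+1}`. -/
def ctlIdeal (d n : ℕ) (u : ℂ) : TwoSidedIdeal (Y d n u) :=
  TwoSidedIdeal.span {a | ∃ (i : ℕ) (hi : i + 2 < n), a = cElem i hi}

/-- The Complex Reflection Temperley-Lieb algebra `CTL_{d,n}(u)`. -/
abbrev CTL (d n : ℕ) (u : ℂ) : Type := (ctlIdeal d n u).ringCon.Quotient

/-- The functional `φ` on `Y_{d,n}(u)` passes to the quotient algebra `CTL_{d,n}(u)`. -/
def PassesToCTL {d n : ℕ} {u : ℂ} (φ : Y d n u →ₗ[ℂ] ℂ) : Prop :=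
  ∃ ψ : CTL d n u →ₗ[ℂ] ℂ, ∀ a : Y d n u, ψ ((ctlIdeal d n u).ringCon.mk' a) = φ a

/-- `E^{(m)} = (1/d) ∑_s x_{m+s} x_{-s}`, the common value of the `tr (e_i^{(m)})`. -/
def E {d : ℕ} [NeZero d] (x : ZMod d → ℂ) (m : ZMod d) : ℂ :=
  (1 : ℂ) / (d : ℂ) * ∑ s : ZMod d, x (m + s) * x (-s)

/-- The E-condition: `E^{(m)} = x_m E` for `1 ≤ m ≤ d - 1`. -/
def ECondition {d : ℕ} [NeZero d] (x : ZMod d → ℂ) : Prop :=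
  ∀ m : ZMod d, m ≠ 0 → E x m = x m * E x 0

end YokonumaHecke

end

noncomputable section

namespace YokonumaHecke

/-! ### Cyclic averages of commuting elements of order `d` -/

section Averages

variable {d : ℕ} {A : Type*} [Ring A] [Algebra ℂ A]

/-! Existence of the trace comes from conditional expectations. As a right module, `Y d (n+1) u`
should be the sum of the pieces `g_k ⋯ g_{n-1} t_n^j Y_n` with `k ≤ n` and `j` mod `d`. Instead of
proving a basis theorem, the formulas for left multiplication on these pieces are written down on
`Fin (n+1) → ZMod d → Y d n u` and checked against the defining relations (`Family.induced`).
Applying this representation to the piece of `1` and then closing the last strand, with weights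
`x_j` and `z`, gives a `Y_n`-bimodule map `expect` from `Y_{n+1}` to `Y_n`; composing these maps
gives `markovTrace`.

Every element of `Y_{n+1}` is a combination of elements `a g_{n-1} b` and `a t_n^s` with `a`, `b` in
`Y_n` (`span_lastSet`). This gives uniqueness at once. It also reduces traciality to commuting with
the last generators; the hard case is the last braid generator, which amounts to symmetry of the
form `tr(ε(g a g) b)` (`markovTrace_wrap_mul`).

For the quotient, traciality turns the condition into `tr(a c_{i,i+1}) = 0` for all `a` and `i`. The
elements `c_{i,i+1}` are conjugate because the `g_i` are invertible for `u ≠ 0`. The Markov rules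
bring `a` down to three strands, where `a c_{1,2}` is a scalar multiple of `c_{1,2}`. So only
`tr(c_{1,2}) = 0` remains. With `X = ∑ x_k` this value is `X³ + (u+2) d z X² + (u+1) d² z² X = X (X
+ dz)(X + (u+1)dz)`, which is `d²` times the expression in the theorem. Only `X` and `z` enter, so
`z = -X/d` makes the trace pass for any `x`, in particular for one that violates the E-condition. -/

theorem pow_val_add [NeZero d] {A : Type*} [Monoid A] {a : A} (ha : a ^ d = 1) (k l : ZMod d) :
    a ^ (k + l).val = a ^ k.val * a ^ l.val := by
  rw [ZMod.val_add, ← pow_eq_pow_mod _ ha, pow_add]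

theorem pow_val_natCast {A : Type*} [Monoid A] {a : A} (ha : a ^ d = 1) (m : ℕ) :
    a ^ (m : ZMod d).val = a ^ m := by
  rw [ZMod.val_natCast, ← pow_eq_pow_mod _ ha]

theorem pow_val_neg_natCast [NeZero d] {A : Type*} [Monoid A] {a : A} (ha : a ^ d = 1) {s : ℕ}
    (hs : s ≤ d) :
    a ^ (-(s : ZMod d)).val = a ^ (d - s) := by
  have : (-(s : ZMod d)) = ((d - s : ℕ) : ZMod d) := by
    rw [Nat.cast_sub hs]; simp
  rw [this, pow_val_natCast ha]

theorem sum_range_eq_sum_zmod [NeZero d] {M : Type*} [AddCommMonoid M] (f : ZMod d → M) :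
    ∑ s ∈ Finset.range d, f (s : ZMod d) = ∑ s : ZMod d, f s := by
  refine Finset.sum_bij' (fun s _ => (s : ZMod d)) (fun k _ => k.val) ?_ ?_ ?_ ?_ ?_
  · simp
  · intro k _; simpa using ZMod.val_lt k
  · intro s hs; simpa using ZMod.val_cast_of_lt (by simpa using hs)
  · intro k _; simp
  · simp

theorem framingAverage_eq_sum [NeZero d] {a b : A} (ha : a ^ d = 1) (hb : b ^ d = 1) (m : ℕ) :
    framingAverage d m a b =
      ((1 : ℂ) / (d : ℂ)) • ∑ s : ZMod d, a ^ ((m : ZMod d) + s).val * b ^ (-s).val := by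
  rw [framingAverage, ← sum_range_eq_sum_zmod]
  congr 1
  refine Finset.sum_congr rfl fun s hs => ?_
  rw [pow_val_neg_natCast hb (Finset.mem_range.1 hs).le, ← Nat.cast_add, pow_val_natCast ha]

/-- The average `(1/d) ∑_s a^s b^{-s}` over the cyclic group of order `d`. -/
theorem framingAverage_zero [NeZero d] {a b : A} (ha : a ^ d = 1) (hb : b ^ d = 1) :
    framingAverage d 0 a b =
      ((1 : ℂ) / (d : ℂ)) • ∑ s : ZMod d, a ^ s.val * b ^ (-s).val := by
  rw [framingAverage_eq_sum ha hb]; simp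

theorem framingAverage_comm [NeZero d] {a b : A} (ha : a ^ d = 1) (hb : b ^ d = 1)
    (hab : a * b = b * a) : framingAverage d 0 a b = framingAverage d 0 b a := by
  rw [framingAverage_zero ha hb, framingAverage_zero hb ha, ← Equiv.sum_comp (Equiv.neg _)]
  congr 1
  refine Finset.sum_congr rfl fun s _ => ?_
  have h : Commute a b := hab
  simpa using (h.pow_pow _ _).eq

/-- Semiconjugation passes to powers, products and sums. With `a' = a` and `b' = b` this serves as a
commutation rule, otherwise as the exchange rule for a braid generator. -/
theorem mul_framingAverage {a b a' b' c : A} (m : ℕ) (ha : c * a = a' * c) (hb : c * b = b' * c) :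
    c * framingAverage d m a b = framingAverage d m a' b' * c := by
  have h1 : SemiconjBy c a a' := ha
  have h2 : SemiconjBy c b b' := hb
  simp only [framingAverage, mul_smul_comm, smul_mul_assoc, Finset.mul_sum, Finset.sum_mul]
  congr 1
  exact Finset.sum_congr rfl fun s _ => ((h1.pow_right _).mul_right (h2.pow_right _)).eq

/-- Shifting the summation index by one trades a factor `b` for a factor `a`: under the average the
two elements are interchangeable. -/
theorem framingAverage_mul_left [NeZero d] {a b : A} (ha : a ^ d = 1) (hb : b ^ d = 1)
    (hab : a * b = b * a) :
    framingAverage d 0 a b * b = framingAverage d 0 a b * a := by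
  have h : Commute a b := hab
  rw [framingAverage_zero ha hb, smul_mul_assoc, smul_mul_assoc, Finset.sum_mul, Finset.sum_mul,
    ← Equiv.sum_comp (Equiv.addRight (1 : ZMod d))]
  congr 1
  refine Finset.sum_congr rfl fun s _ => ?_
  have h1 : ∀ {y : A}, y ^ d = 1 → y ^ (1 : ZMod d).val = y := fun hy => by
    simpa using pow_val_natCast hy 1
  have hb1 : b ^ (-(s + 1)).val * b = b ^ (-s).val := by
    nth_rewrite 2 [← h1 hb]
    rw [← pow_val_add hb]
    congr 2
    ring
  simp only [Equiv.coe_addRight]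
  rw [mul_assoc, hb1, pow_val_add ha, h1 ha, mul_assoc, mul_assoc, (h.pow_right _).eq]

theorem framingAverage_mul_pow [NeZero d] {a b : A} (ha : a ^ d = 1) (hb : b ^ d = 1)
    (hab : a * b = b * a) (k : ℕ) :
    framingAverage d 0 a b * b ^ k = framingAverage d 0 a b * a ^ k := by
  have h : Commute a b := hab
  induction k with
  | zero => simp
  | succ k ih =>
    rw [pow_succ, ← mul_assoc, ih, mul_assoc, (h.pow_left k).eq, ← mul_assoc,
      framingAverage_mul_left ha hb hab, mul_assoc, ← pow_succ']

/-- The left factor allows `c` to be replaced by `b`, term by term in the second average. -/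
theorem framingAverage_mul_framingAverage [NeZero d] {a b c : A} (hb : b ^ d = 1)
    (hc : c ^ d = 1) (hbc : b * c = c * b) (hab : a * b = b * a) (hac : a * c = c * a) :
    framingAverage d 0 b c * framingAverage d 0 a c
      = framingAverage d 0 b c * framingAverage d 0 a b := by
  have e1 : framingAverage d 0 b c * a = a * framingAverage d 0 b c :=
    (mul_framingAverage 0 hab hac).symm
  have e2 : ∀ s, framingAverage d 0 b c * a ^ s = a ^ s * framingAverage d 0 b c :=
    fun s => (Commute.pow_right e1 s)
  conv_lhs => rhs; rw [framingAverage]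
  conv_rhs => rhs; rw [framingAverage]
  simp only [mul_smul_comm, Finset.mul_sum, ← mul_assoc, e2]
  simp only [mul_assoc, framingAverage_mul_pow hb hc hbc]

end Averages

/-! ### The universal property of `Y d n u` -/

/-- Families `G`, `T` in an algebra that satisfy the defining relations of `Y_{d,n}(u)`. -/
structure Family (d n : ℕ) (u : ℂ) {A : Type*} [Ring A] [Algebra ℂ A] (G T : ℕ → A) : Prop where
  g_comm : ∀ i j, j + 1 < n → i + 1 < j → G i * G j = G j * G i
  braid : ∀ i, i + 2 < n → G (i + 1) * G i * G (i + 1) = G i * G (i + 1) * G i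
  t_comm : ∀ i j, i < n → j < n → T i * T j = T j * T i
  t_pow : ∀ i, i < n → T i ^ d = 1
  g_t_left : ∀ i, i + 1 < n → G i * T i = T (i + 1) * G i
  g_t_right : ∀ i, i + 1 < n → G i * T (i + 1) = T i * G i
  g_t_comm : ∀ i j, i + 1 < n → j < n → j ≠ i → j ≠ i + 1 → G i * T j = T j * G i
  quadratic : ∀ i, i + 1 < n → G i * G i = 1 + (u - 1) • framingAverage d 0 (T i) (T (i + 1))
    + (u - 1) • (framingAverage d 0 (T i) (T (i + 1)) * G i)

namespace Family

variable {d n : ℕ} {u : ℂ} {A : Type*} [Ring A] [Algebra ℂ A] {G T : ℕ → A}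

theorem map {B : Type*} [Ring B] [Algebra ℂ B] (h : Family d n u G T) (f : A →ₐ[ℂ] B) :
    Family d n u (fun i => f (G i)) (fun i => f (T i)) where
  g_comm i j hj hij := by simp only [← map_mul, h.g_comm i j hj hij]
  braid i hi := by simp only [← map_mul, h.braid i hi]
  t_comm i j hi hj := by simp only [← map_mul, h.t_comm i j hi hj]
  t_pow i hi := by simp only [← map_pow, h.t_pow i hi, map_one]
  g_t_left i hi := by simp only [← map_mul, h.g_t_left i hi]
  g_t_right i hi := by simp only [← map_mul, h.g_t_right i hi]
  g_t_comm i j hi hj h1 h2 := by simp only [← map_mul, h.g_t_comm i j hi hj h1 h2]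
  quadratic i hi := by
    simp only [← map_mul, h.quadratic i hi, ← map_framingAverage, map_add, map_smul, map_one]

/-- The values of a family on the generators. -/
def genMap (n : ℕ) (G T : ℕ → A) : Gen n → A
  | Gen.g i _ => G i
  | Gen.t j _ => T j

theorem genMap_rel (h : Family d n u G T) ⦃a b : FreeAlgebra ℂ (Gen n)⦄ (hr : Rel d n u a b) :
    FreeAlgebra.lift ℂ (genMap n G T) a = FreeAlgebra.lift ℂ (genMap n G T) b := by
  have hg : ∀ i (hi : i + 1 < n), FreeAlgebra.lift ℂ (genMap n G T) (freeG i hi) = G i := by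
    intro i hi; simp [freeG, genMap]
  have ht : ∀ i (hi : i < n), FreeAlgebra.lift ℂ (genMap n G T) (freeT i hi) = T i := by
    intro i hi; simp [freeT, genMap]
  induction hr <;>
    simp only [map_mul, map_pow, map_add, map_one, map_smul, map_framingAverage, hg, ht]
  case g_comm hi hj hij =>
    rcases hij with hij | hij
    · exact h.g_comm _ _ hj hij
    · exact (h.g_comm _ _ hi hij).symm
  case braid hi => exact h.braid _ hi
  case t_comm hi hj => exact h.t_comm _ _ hi hj
  case t_pow hi => exact h.t_pow _ hi
  case g_t_left hi _ => exact h.g_t_left _ hi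
  case g_t_right hi _ => exact h.g_t_right _ hi
  case g_t_comm hi hj h1 h2 => exact h.g_t_comm _ _ hi hj h1 h2
  case quadratic hi _ => rw [pow_two]; exact h.quadratic _ hi

/-- The algebra map from `Y_{d,n}(u)` given by a family. -/
def lift (h : Family d n u G T) : Y d n u →ₐ[ℂ] A :=
  RingQuot.liftAlgHom ℂ ⟨FreeAlgebra.lift ℂ (genMap n G T), h.genMap_rel⟩

@[simp] theorem lift_g (h : Family d n u G T) (i : ℕ) (hi : i + 1 < n) :
    h.lift (g i hi) = G i := by
  simp [lift, g, freeG, genMap]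

@[simp] theorem lift_t (h : Family d n u G T) (i : ℕ) (hi : i < n) :
    h.lift (t i hi) = T i := by
  simp [lift, t, freeT, genMap]

end Family

/-! ### Generators with unrestricted indices -/

section Total

variable {d n : ℕ} {u : ℂ}

/-- The generator `g_i`, extended by `0` to all indices. -/
def gg (i : ℕ) : Y d n u := if hi : i + 1 < n then g i hi else 0

/-- The generator `t_i`, extended by `0` to all indices. -/
def tt (i : ℕ) : Y d n u := if hi : i < n then t i hi else 0

theorem g_eq (i : ℕ) (hi : i + 1 < n) : (g i hi : Y d n u) = gg i := by simp [gg, hi]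

theorem t_eq (i : ℕ) (hi : i < n) : (t i hi : Y d n u) = tt i := by simp [tt, hi]

theorem family (d n : ℕ) (u : ℂ) : Family d n u (gg : ℕ → Y d n u) tt := by
  have key : ∀ {a b}, Rel d n u a b → RingQuot.mkAlgHom ℂ (Rel d n u) a
      = RingQuot.mkAlgHom ℂ (Rel d n u) b := fun h => RingQuot.mkAlgHom_rel ℂ h
  constructor
  · intro i j hj hij
    have hi : i + 1 < n := by omega
    simpa [g, g_eq, ← g_eq _ hi, ← g_eq _ hj] using key (Rel.g_comm i j hi hj (Or.inl hij))
  · intro i hi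
    have hi' : i + 1 < n := by omega
    simpa [g, ← g_eq _ hi, ← g_eq _ hi'] using key (Rel.braid i hi' hi)
  · intro i j hi hj
    simpa [t, ← t_eq _ hi, ← t_eq _ hj] using key (Rel.t_comm i j hi hj)
  · intro i hi
    simpa [t, ← t_eq _ hi] using key (Rel.t_pow i hi)
  · intro i hi
    have hi' : i < n := by omega
    simpa [g, t, ← g_eq _ hi, ← t_eq _ hi, ← t_eq _ hi'] using key (Rel.g_t_left i hi hi')
  · intro i hi
    have hi' : i < n := by omega
    simpa [g, t, ← g_eq _ hi, ← t_eq _ hi, ← t_eq _ hi'] using key (Rel.g_t_right i hi hi')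
  · intro i j hi hj h1 h2
    simpa [g, t, ← g_eq _ hi, ← t_eq _ hj] using key (Rel.g_t_comm i j hi hj h1 h2)
  · intro i hi
    have hi' : i < n := by omega
    have := key (Rel.quadratic i hi hi')
    simp only [map_add, map_one, map_smul, map_mul, map_framingAverage, pow_two] at this
    simpa only [g, t, ← g_eq _ hi, ← t_eq _ hi, ← t_eq _ hi'] using this

/-- Induction along left multiplication by generators. -/
theorem induction_mul {P : Y d n u → Prop} (one : P 1) (add : ∀ a b, P a → P b → P (a + b))
    (smul : ∀ (c : ℂ) a, P a → P (c • a))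
    (g_mul : ∀ i, i + 1 < n → ∀ a, P a → P (gg i * a))
    (t_mul : ∀ i, i < n → ∀ a, P a → P (tt i * a)) (a : Y d n u) : P a := by
  obtain ⟨b, rfl⟩ := RingQuot.mkAlgHom_surjective ℂ (Rel d n u) a
  -- Stability of `P` under left multiplication by `b` is preserved by products of such `b`, which
  -- `P b` alone need not be.
  suffices ∀ y, P y → P (RingQuot.mkAlgHom ℂ (Rel d n u) b * y) by simpa using this 1 one
  induction b using FreeAlgebra.induction with
  | grade0 r =>
    intro y hy
    rw [AlgHom.commutes, ← Algebra.smul_def]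
    exact smul r y hy
  | grade1 x =>
    intro y hy
    cases x with
    | g i hi => have := g_mul i hi y hy; rwa [← g_eq i hi] at this
    | t i hi => have := t_mul i hi y hy; rwa [← t_eq i hi] at this
  | mul a b ha hb =>
    intro y hy
    rw [map_mul, mul_assoc]
    exact ha _ (hb _ hy)
  | add a b ha hb =>
    intro y hy
    rw [map_add, add_mul]
    exact add _ _ (ha _ hy) (hb _ hy)

theorem incl_gg {i : ℕ} (hi : i + 1 < n) : incl d n u (gg i) = gg i := by
  rw [← g_eq i hi, ← g_eq i (Nat.lt_succ_of_lt hi)]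
  simp [incl, g, freeG, inclGen]

theorem incl_tt {i : ℕ} (hi : i < n) : incl d n u (tt i) = tt i := by
  rw [← t_eq i hi, ← t_eq i (Nat.lt_succ_of_lt hi)]
  simp [incl, t, freeT, inclGen]

end Total

/-! ### The induced module and its relations -/

section Induced

variable {d n : ℕ} {u : ℂ} {N : Type*} [AddCommGroup N] [Module ℂ N]

/-- The diagonal operators on a power of a vector space. -/
def diagonalEnd (n : ℕ) (N : Type*) [AddCommGroup N] [Module ℂ N] :
    (Fin n → Module.End ℂ N) →ₐ[ℂ] Module.End ℂ (Fin n → N) :=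
  AlgHom.ofLinearMap
    { toFun := fun f => LinearMap.pi fun k => f k ∘ₗ LinearMap.proj k
      map_add' := fun f f' => by ext; simp
      map_smul' := fun c f => by ext; simp }
    (by ext; simp) (fun f f' => by ext; simp)

@[simp] theorem diagonalEnd_apply (f : Fin n → Module.End ℂ N) (v : Fin n → N) (k : Fin n) :
    diagonalEnd n N f v k = f k (v k) := rfl

/-- Diagonal entries of the action of `t_i` on the induced module. -/
def indTEntry (n : ℕ) (T : ℕ → Module.End ℂ N) (τ : Module.End ℂ N) (i : ℕ) (k : Fin (n + 1)) :
    Module.End ℂ N :=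
  if k.val < i then T (i - 1) else if k.val = i then τ else T i

/-- The action of `t_i` on the module induced from `n` to `n + 1` strands. The `k`-th summand
belongs to the coset of `g_k ⋯ g_{n-1}`. -/
def indT (n : ℕ) (T : ℕ → Module.End ℂ N) (τ : Module.End ℂ N) (i : ℕ) :
    Module.End ℂ (Fin (n + 1) → N) :=
  diagonalEnd (n + 1) N (indTEntry n T τ i)

/-- The action of `g_i`, `i < n`, on the module induced from `n` to `n + 1` strands. -/
def indGAux (n : ℕ) (u : ℂ) (G p : ℕ → Module.End ℂ N) (i : ℕ) (hi : i < n) :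
    Module.End ℂ (Fin (n + 1) → N) where
  toFun v k :=
    if k.val < i then G (i - 1) (v k)
    -- Left multiplication by `g_i` sends the coset of `g_{i+1} ⋯ g_{n-1}` to that of `g_i ⋯
    -- g_{n-1}`; in the opposite direction `g_i²` appears and is expanded by the quadratic relation.
    -- On both cosets `e_i` acts as `p i`, the average of `T i` and `τ`.
    else if k.val = i then v ⟨i + 1, by omega⟩ + (u - 1) • p i (v ⟨i, by omega⟩)
    else if k.val = i + 1 then v ⟨i, by omega⟩ + (u - 1) • p i (v ⟨i, by omega⟩)
    else G i (v k)
  map_add' v w := by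
    ext k
    simp only [Pi.add_apply, map_add, smul_add]
    split_ifs <;> abel
  map_smul' c v := by
    ext k
    simp only [Pi.smul_apply, map_smul, RingHom.id_apply]
    split_ifs <;> module

/-- The action of `g_i` on the module induced from `n` to `n + 1` strands, extended by `0` to all
indices. -/
def indG (d n : ℕ) (u : ℂ) (G T : ℕ → Module.End ℂ N) (τ : Module.End ℂ N) (i : ℕ) :
    Module.End ℂ (Fin (n + 1) → N) :=
  if hi : i < n then indGAux n u G (fun j => framingAverage d 0 (T j) τ) i hi else 0

variable {G T : ℕ → Module.End ℂ N} {τ : Module.End ℂ N}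

theorem indT_apply_of_lt {i k : ℕ} (hk : k < n + 1) (h : k < i) (v : Fin (n + 1) → N) :
    indT n T τ i v ⟨k, hk⟩ = T (i - 1) (v ⟨k, hk⟩) := by
  simp [indT, indTEntry, h]

theorem indT_apply_self {i : ℕ} (hk : i < n + 1) (v : Fin (n + 1) → N) :
    indT n T τ i v ⟨i, hk⟩ = τ (v ⟨i, hk⟩) := by
  simp [indT, indTEntry]

theorem indT_apply_of_gt {i k : ℕ} (hk : k < n + 1) (h : i < k) (v : Fin (n + 1) → N) :
    indT n T τ i v ⟨k, hk⟩ = T i (v ⟨k, hk⟩) := by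
  simp [indT, indTEntry, h.not_gt, h.ne']

theorem indG_apply_of_lt {i k : ℕ} (hi : i < n) (hk : k < n + 1) (h : k < i)
    (v : Fin (n + 1) → N) :
    indG d n u G T τ i v ⟨k, hk⟩ = G (i - 1) (v ⟨k, hk⟩) := by
  simp [indG, indGAux, h, hi]

theorem indG_apply_self {i : ℕ} (hi : i < n) (hk : i < n + 1) (v : Fin (n + 1) → N) :
    indG d n u G T τ i v ⟨i, hk⟩ = v ⟨i + 1, Nat.succ_lt_succ hi⟩
      + (u - 1) • framingAverage d 0 (T i) τ (v ⟨i, hk⟩) := by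
  simp [indG, indGAux, hi]

theorem indG_apply_succ {i : ℕ} (hi : i < n) (hk : i + 1 < n + 1) (v : Fin (n + 1) → N) :
    indG d n u G T τ i v ⟨i + 1, hk⟩ = v ⟨i, Nat.lt_succ_of_lt hi⟩
      + (u - 1) • framingAverage d 0 (T i) τ (v ⟨i, Nat.lt_succ_of_lt hi⟩) := by
  simp [indG, indGAux, hi]

theorem indG_apply_of_gt {i k : ℕ} (hi : i < n) (hk : k < n + 1) (h : i + 1 < k)
    (v : Fin (n + 1) → N) :
    indG d n u G T τ i v ⟨k, hk⟩ = G i (v ⟨k, hk⟩) := by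
  have h1 : ¬ k < i := by omega
  have h2 : k ≠ i := by omega
  simp [indG, indGAux, h1, h2, h.ne', hi]

theorem indT_framingAverage_apply (i j : ℕ) (v : Fin (n + 1) → N) (k : Fin (n + 1)) :
    framingAverage d 0 (indT n T τ i) (indT n T τ j) v k
      = framingAverage d 0 (indTEntry n T τ i k) (indTEntry n T τ j k) (v k) := by
  rw [indT, indT, ← map_framingAverage, diagonalEnd_apply]
  exact congrArg (fun f : Module.End ℂ N => f (v k))
    (map_framingAverage d (Pi.evalAlgHom ℂ (fun _ : Fin (n + 1) => Module.End ℂ N) k) 0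
      (indTEntry n T τ i) (indTEntry n T τ j))

/-- An operator `τ` of order `d` that commutes with a family on `n` strands. -/
structure Framing (d n : ℕ) (G T : ℕ → Module.End ℂ N) (τ : Module.End ℂ N) : Prop where
  pow : τ ^ d = 1
  comm_g : ∀ i, i + 1 < n → G i * τ = τ * G i
  comm_t : ∀ i, i < n → T i * τ = τ * T i

theorem indTEntry_pow (h : Family d n u G T) (hτ : Framing d n G T τ) {i : ℕ} (hi : i < n + 1)
    (k : Fin (n + 1)) : indTEntry n T τ i k ^ d = 1 := by
  unfold indTEntry
  split_ifs
  · exact h.t_pow _ (by omega)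
  · exact hτ.pow
  · exact h.t_pow _ (by omega)

theorem indTEntry_comm (h : Family d n u G T) (hτ : Framing d n G T τ) {i j : ℕ}
    (hi : i < n + 1) (hj : j < n + 1) (k : Fin (n + 1)) :
    indTEntry n T τ i k * indTEntry n T τ j k = indTEntry n T τ j k * indTEntry n T τ i k := by
  unfold indTEntry
  split_ifs <;> first
    | rfl
    | exact h.t_comm _ _ (by omega) (by omega)
    | exact hτ.comm_t _ (by omega)
    | exact (hτ.comm_t _ (by omega)).symm

theorem indG_comm (h : Family d n u G T) (hτ : Framing d n G T τ) {i j : ℕ} (hj : j < n)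
    (hij : i + 1 < j) :
    indG d n u G T τ i * indG d n u G T τ j = indG d n u G T τ j * indG d n u G T τ i := by
  have hi : i < n := by omega
  have e : ∀ {a b : Module.End ℂ N}, a * b = b * a → ∀ w, a (b w) = b (a w) :=
    fun hab w => LinearMap.congr_fun hab w
  refine LinearMap.ext fun v => funext fun k => ?_
  obtain ⟨k, hk⟩ := k
  simp only [Module.End.mul_apply]
  rcases lt_or_ge k i with h1 | h1
  · rw [indG_apply_of_lt hi _ h1, indG_apply_of_lt hj _ (by omega),
      indG_apply_of_lt hj _ (by omega), indG_apply_of_lt hi _ h1]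
    exact e (h.g_comm _ _ (by omega) (by omega)) _
  rcases h1.eq_or_lt with rfl | h1
  · rw [indG_apply_self hi, indG_apply_of_lt hj _ (by omega), indG_apply_of_lt hj _ (by omega),
      indG_apply_of_lt hj _ (by omega), indG_apply_self hi, map_add, map_smul]
    congr 2
    refine (e (mul_framingAverage 0 ?_ ?_) _).symm
    · exact h.g_t_comm _ _ (by omega) (by omega) (by omega) (by omega)
    · exact hτ.comm_g _ (by omega)
  rcases (Nat.succ_le_of_lt h1).eq_or_lt with rfl | h1
  · rw [indG_apply_succ hi, indG_apply_of_lt hj _ (by omega), indG_apply_of_lt hj _ (by omega),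
      indG_apply_succ hi, map_add, map_smul]
    congr 2
    refine (e (mul_framingAverage 0 ?_ ?_) _).symm
    · exact h.g_t_comm _ _ (by omega) (by omega) (by omega) (by omega)
    · exact hτ.comm_g _ (by omega)
  have h1 : i + 1 < k := h1
  rcases lt_or_ge k j with h2 | h2
  · rw [indG_apply_of_gt hi _ h1, indG_apply_of_lt hj _ h2, indG_apply_of_lt hj _ h2,
      indG_apply_of_gt hi _ h1]
    obtain ⟨j, rfl⟩ : ∃ j', j = j' + 1 := ⟨j - 1, by omega⟩
    exact e (h.g_comm _ _ (by omega) (by simp; omega)) _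
  rcases h2.eq_or_lt with rfl | h2
  · rw [indG_apply_of_gt hi _ h1, indG_apply_self hj, indG_apply_self hj,
      indG_apply_of_gt hi _ h1, indG_apply_of_gt hi _ (by omega), map_add, map_smul]
    congr 2
    refine (e (mul_framingAverage 0 ?_ ?_) _)
    · exact h.g_t_comm _ _ (by omega) (by omega) (by omega) (by omega)
    · exact hτ.comm_g _ (by omega)
  rcases (Nat.succ_le_of_lt h2).eq_or_lt with rfl | h2
  · rw [indG_apply_of_gt hi _ h1, indG_apply_succ hj, indG_apply_succ hj,
      indG_apply_of_gt hi _ (by omega), map_add, map_smul]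
    congr 2
    refine (e (mul_framingAverage 0 ?_ ?_) _)
    · exact h.g_t_comm _ _ (by omega) (by omega) (by omega) (by omega)
    · exact hτ.comm_g _ (by omega)
  have h2 : j + 1 < k := h2
  rw [indG_apply_of_gt hi _ h1, indG_apply_of_gt hj _ h2, indG_apply_of_gt hj _ h2,
      indG_apply_of_gt hi _ h1]
  exact e (h.g_comm _ _ (by omega) hij) _

/-- Only the components `i`, `i+1`, `i+2` are mixed; elsewhere this is the braid relation of the
given family. On the mixed components everything follows by moving the averages `p`, `q` past `G i`,
which exchanges them; component `i` also needs the quadratic relation. -/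
theorem indG_braid [NeZero d] (h : Family d n u G T) (hτ : Framing d n G T τ) {i : ℕ}
    (hi : i + 1 < n) :
    indG d n u G T τ (i + 1) * indG d n u G T τ i * indG d n u G T τ (i + 1)
      = indG d n u G T τ i * indG d n u G T τ (i + 1) * indG d n u G T τ i := by
  have hi' : i < n := by omega
  have e3 : ∀ {a b : Module.End ℂ N}, a * b * a = b * a * b →
    ∀ w, a (b (a w)) = b (a (b w)) := fun hab w => LinearMap.congr_fun hab w
  have e : ∀ {a b c f : Module.End ℂ N}, a * b = c * f → ∀ w, a (b w) = c (f w) :=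
    fun hab w => LinearMap.congr_fun hab w
  set p := framingAverage d 0 (T i) τ with hp
  set q := framingAverage d 0 (T (i + 1)) τ with hq
  set E := framingAverage d 0 (T i) (T (i + 1)) with hE
  have hGp : ∀ w, G i (p w) = q (G i w) :=
    e (mul_framingAverage 0 (h.g_t_left i hi) (hτ.comm_g i hi))
  have hGq : ∀ w, G i (q w) = p (G i w) :=
    e (mul_framingAverage 0 (h.g_t_right i hi) (hτ.comm_g i hi))
  have hcp : T (i + 1) * p = p * T (i + 1) :=
    mul_framingAverage 0 (h.t_comm _ _ hi hi') (hτ.comm_t _ hi)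
  have hcτ : τ * p = p * τ := mul_framingAverage 0 (hτ.comm_t _ hi').symm rfl
  have hpq : ∀ w, p (q w) = q (p w) := e (mul_framingAverage 0 hcp.symm hcτ.symm)
  -- The quadratic relation of `G i` produces `E`, whereas the other side of the braid relation
  -- contains `p`. They agree behind `q`, which identifies `T (i+1)` with `τ`.
  have hqE : ∀ w, q (E w) = q (p w) := e
    (framingAverage_mul_framingAverage (h.t_pow _ hi) hτ.pow (hτ.comm_t _ hi)
      (h.t_comm _ _ hi' hi) (hτ.comm_t _ hi')).symm
  have hGG : ∀ w, G i (G i w) = w + (u - 1) • E w + (u - 1) • E (G i w) :=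
    fun w => LinearMap.congr_fun (h.quadratic i hi) w
  refine LinearMap.ext fun v => funext fun k => ?_
  obtain ⟨k, hk⟩ := k
  simp only [Module.End.mul_apply]
  rcases lt_or_ge k i with h1 | h1
  · simp only [indG_apply_of_lt hi' _ h1, indG_apply_of_lt hi _ (Nat.lt_succ_of_lt h1)]
    obtain ⟨i, rfl⟩ : ∃ j, i = j + 1 := ⟨i - 1, by omega⟩
    exact e3 (h.braid i (by omega)) _
  rcases h1.eq_or_lt with rfl | h1
  · simp only [indG_apply_of_lt hi _ (Nat.lt_add_one _), indG_apply_self hi',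
      indG_apply_self hi, Nat.add_sub_cancel, ← hp, ← hq, indG_apply_succ hi',
      indG_apply_of_gt hi' _ (Nat.lt_add_one _), map_add, map_smul, hGp, hGG, hqE, hGq, hpq]
    module
  rcases (Nat.succ_le_of_lt h1).eq_or_lt with h1 | h1
  · obtain rfl : k = i + 1 := h1.symm
    simp only [indG_apply_of_lt hi _ (Nat.lt_add_one _), indG_apply_self hi',
      indG_apply_self hi, Nat.add_sub_cancel, ← hp, ← hq, indG_apply_succ hi', indG_apply_succ hi,
      indG_apply_of_gt hi' _ (Nat.lt_add_one _), map_add, map_smul, hGp, hGq, hpq]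
    module
  rcases (Nat.succ_le_of_lt h1).eq_or_lt with h1 | h1
  · obtain rfl : k = i + 1 + 1 := h1.symm
    simp only [indG_apply_of_lt hi _ (Nat.lt_add_one _), Nat.add_sub_cancel, ← hp, ← hq,
      indG_apply_succ hi', indG_apply_succ hi, indG_apply_of_gt hi' _ (Nat.lt_add_one _), map_add,
      map_smul, hGp, hGq, hpq]
    module
  have h1 : i + 1 + 1 < k := h1
  simp only [indG_apply_of_gt hi' _ (Nat.lt_of_succ_lt h1), indG_apply_of_gt hi _ h1]
  exact e3 (h.braid i (by omega)) _

/-- On the components `i` and `i+1` one of the two framing operators is `τ` and the other `T i`, so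
the average there is always `p i`, and the relation is built into the formula for `indG`. -/
theorem indG_quadratic [NeZero d] (h : Family d n u G T) (hτ : Framing d n G T τ) {i : ℕ}
    (hi : i < n) :
    indG d n u G T τ i * indG d n u G T τ i
      = 1 + (u - 1) • framingAverage d 0 (indT n T τ i) (indT n T τ (i + 1))
        + (u - 1) • (framingAverage d 0 (indT n T τ i) (indT n T τ (i + 1))
          * indG d n u G T τ i) := by
  refine LinearMap.ext fun v => funext fun k => ?_
  obtain ⟨k, hk⟩ := k
  simp only [Module.End.mul_apply, LinearMap.add_apply, LinearMap.smul_apply, Pi.add_apply,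
    Pi.smul_apply, indT_framingAverage_apply, Module.End.one_apply]
  rcases lt_or_ge k i with h1 | h1
  · have h2 : k < i + 1 := by omega
    simp only [indG_apply_of_lt hi _ h1, indTEntry, h1, h2, if_true]
    obtain ⟨i, rfl⟩ : ∃ j, i = j + 1 := ⟨i - 1, by omega⟩
    exact LinearMap.congr_fun (h.quadratic i hi) (v ⟨k, hk⟩)
  rcases h1.eq_or_lt with rfl | h1
  · have h2 : i < i + 1 := by omega
    simp only [indTEntry, lt_irrefl, if_true, if_false, h2, Nat.add_sub_cancel,
      framingAverage_comm hτ.pow (h.t_pow i hi) (hτ.comm_t i hi).symm, indG_apply_self hi,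
      indG_apply_succ hi]
  rcases (Nat.succ_le_of_lt h1).eq_or_lt with h1 | h1
  · obtain rfl : k = i + 1 := h1.symm
    have h2 : ¬ i + 1 < i := by omega
    have h3 : i + 1 ≠ i := by omega
    simp only [indTEntry, lt_irrefl, if_true, if_false, h2, h3, indG_apply_self hi,
      indG_apply_succ hi, map_add, map_smul]
    module
  have h1 : i + 1 < k := h1
  have h2 : ¬ k < i := by omega
  have h3 : k ≠ i := by omega
  have h4 : ¬ k < i + 1 := by omega
  have h5 : k ≠ i + 1 := by omega
  simp only [indTEntry, if_false, h2, h3, h4, h5, indG_apply_of_gt hi _ h1]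
  exact LinearMap.congr_fun (h.quadratic i (by omega)) (v ⟨k, hk⟩)

/-- The swap of the components `i` and `i+1` matches the swap of `T i` and `τ`. The correction terms
agree since the average does not distinguish these two operators. -/
theorem indG_indT_left [NeZero d] (h : Family d n u G T) (hτ : Framing d n G T τ) {i : ℕ}
    (hi : i < n) :
    indG d n u G T τ i * indT n T τ i = indT n T τ (i + 1) * indG d n u G T τ i := by
  have e : ∀ {a b c f : Module.End ℂ N}, a * b = c * f → ∀ w, a (b w) = c (f w) :=
    fun hab w => LinearMap.congr_fun hab w
  have hcT : ∀ w, T i (framingAverage d 0 (T i) τ w) = framingAverage d 0 (T i) τ (T i w) :=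
    e (mul_framingAverage 0 rfl (hτ.comm_t _ hi))
  have hcτ : ∀ w, τ (framingAverage d 0 (T i) τ w) = framingAverage d 0 (T i) τ (τ w) :=
    e (mul_framingAverage 0 (hτ.comm_t _ hi).symm rfl)
  have hpτ : ∀ w, framingAverage d 0 (T i) τ (τ w) = framingAverage d 0 (T i) τ (T i w) :=
    e (framingAverage_mul_left (h.t_pow i hi) hτ.pow (hτ.comm_t _ hi))
  refine LinearMap.ext fun v => funext fun k => ?_
  obtain ⟨k, hk⟩ := k
  simp only [Module.End.mul_apply]
  rcases lt_or_ge k i with h1 | h1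
  · simp only [indG_apply_of_lt hi _ h1, indT_apply_of_lt _ h1,
      indT_apply_of_lt _ (Nat.lt_succ_of_lt h1)]
    obtain ⟨i, rfl⟩ : ∃ j, i = j + 1 := ⟨i - 1, by omega⟩
    exact e (h.g_t_left i hi) _
  rcases h1.eq_or_lt with rfl | h1
  · simp only [indG_apply_self hi, indT_apply_self, indT_apply_of_gt _ (Nat.lt_add_one _),
      indT_apply_of_lt _ (Nat.lt_add_one _), Nat.add_sub_cancel, map_add, map_smul, hcT, hpτ]
  rcases (Nat.succ_le_of_lt h1).eq_or_lt with h1 | h1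
  · obtain rfl : k = i + 1 := h1.symm
    simp only [indG_apply_succ hi, indT_apply_self, map_add, map_smul, hcτ]
  have h1 : i + 1 < k := h1
  simp only [indG_apply_of_gt hi _ h1, indT_apply_of_gt _ h1,
    indT_apply_of_gt _ (Nat.lt_of_succ_lt h1)]
  exact e (h.g_t_left i (by omega)) _

theorem indG_indT_right [NeZero d] (h : Family d n u G T) (hτ : Framing d n G T τ) {i : ℕ}
    (hi : i < n) :
    indG d n u G T τ i * indT n T τ (i + 1) = indT n T τ i * indG d n u G T τ i := by
  have e : ∀ {a b c f : Module.End ℂ N}, a * b = c * f → ∀ w, a (b w) = c (f w) :=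
    fun hab w => LinearMap.congr_fun hab w
  have hcT : ∀ w, T i (framingAverage d 0 (T i) τ w) = framingAverage d 0 (T i) τ (T i w) :=
    e (mul_framingAverage 0 rfl (hτ.comm_t _ hi))
  have hcτ : ∀ w, τ (framingAverage d 0 (T i) τ w) = framingAverage d 0 (T i) τ (τ w) :=
    e (mul_framingAverage 0 (hτ.comm_t _ hi).symm rfl)
  have hpτ : ∀ w, framingAverage d 0 (T i) τ (τ w) = framingAverage d 0 (T i) τ (T i w) :=
    e (framingAverage_mul_left (h.t_pow i hi) hτ.pow (hτ.comm_t _ hi))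
  refine LinearMap.ext fun v => funext fun k => ?_
  obtain ⟨k, hk⟩ := k
  simp only [Module.End.mul_apply]
  rcases lt_or_ge k i with h1 | h1
  · simp only [indG_apply_of_lt hi _ h1, indT_apply_of_lt _ h1,
      indT_apply_of_lt _ (Nat.lt_succ_of_lt h1)]
    obtain ⟨i, rfl⟩ : ∃ j, i = j + 1 := ⟨i - 1, by omega⟩
    exact e (h.g_t_right i hi) _
  rcases h1.eq_or_lt with rfl | h1
  · simp only [indG_apply_self hi, indT_apply_self,
      indT_apply_of_lt _ (Nat.lt_add_one _), Nat.add_sub_cancel, map_add, map_smul, hcτ, hpτ]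
  rcases (Nat.succ_le_of_lt h1).eq_or_lt with h1 | h1
  · obtain rfl : k = i + 1 := h1.symm
    simp only [indG_apply_succ hi, indT_apply_of_gt _ (Nat.lt_add_one _),
      indT_apply_of_lt _ (Nat.lt_add_one _), Nat.add_sub_cancel, map_add, map_smul, hcT]
  have h1 : i + 1 < k := h1
  simp only [indG_apply_of_gt hi _ h1, indT_apply_of_gt _ h1,
    indT_apply_of_gt _ (Nat.lt_of_succ_lt h1)]
  exact e (h.g_t_right i (by omega)) _

theorem indG_indT_comm (h : Family d n u G T) (hτ : Framing d n G T τ) {i j : ℕ} (hi : i < n)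
    (hj : j < n + 1) (hji : j ≠ i) (hji' : j ≠ i + 1) :
    indG d n u G T τ i * indT n T τ j = indT n T τ j * indG d n u G T τ i := by
  have e : ∀ {a b c f : Module.End ℂ N}, a * b = c * f → ∀ w, a (b w) = c (f w) :=
    fun hab w => LinearMap.congr_fun hab w
  have hcT : ∀ m, m < n → ∀ w,
      T m (framingAverage d 0 (T i) τ w) = framingAverage d 0 (T i) τ (T m w) :=
    fun m hm => e (mul_framingAverage 0 (h.t_comm _ _ hm hi) (hτ.comm_t _ hm))
  refine LinearMap.ext fun v => funext fun k => ?_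
  obtain ⟨k, hk⟩ := k
  simp only [Module.End.mul_apply]
  rcases lt_or_ge k i with h1 | h1
  · rw [indG_apply_of_lt hi _ h1]
    rcases lt_trichotomy k j with h2 | rfl | h2
    · rw [indT_apply_of_lt _ h2, indT_apply_of_lt _ h2, indG_apply_of_lt hi _ h1]
      exact e (h.g_t_comm _ _ (by omega) (by omega) (by omega) (by omega)) _
    · rw [indT_apply_self, indT_apply_self, indG_apply_of_lt hi _ h1]
      exact e (hτ.comm_g _ (by omega)) _
    · rw [indT_apply_of_gt _ h2, indT_apply_of_gt _ h2, indG_apply_of_lt hi _ h1]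
      exact e (h.g_t_comm _ _ (by omega) (by omega) (by omega) (by omega)) _
  rcases h1.eq_or_lt with rfl | h1
  · rcases lt_or_gt_of_ne hji with h2 | h2
    · simp only [indG_apply_self hi, indT_apply_of_gt _ h2, indT_apply_of_gt _
        (Nat.lt_succ_of_lt h2), map_add, map_smul, hcT j (h2.trans hi)]
    · have h3 : i + 1 < j := by omega
      simp only [indG_apply_self hi, indT_apply_of_lt _ h2, indT_apply_of_lt _ h3, map_add,
        map_smul, hcT (j - 1) (by omega)]
  rcases (Nat.succ_le_of_lt h1).eq_or_lt with h1 | h1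
  · obtain rfl : k = i + 1 := h1.symm
    rcases lt_or_gt_of_ne hji with h2 | h2
    · simp only [indG_apply_succ hi, indT_apply_of_gt _ h2, indT_apply_of_gt _
        (Nat.lt_succ_of_lt h2), map_add, map_smul, hcT j (h2.trans hi)]
    · have h3 : i + 1 < j := by omega
      simp only [indG_apply_succ hi, indT_apply_of_lt _ h2, indT_apply_of_lt _ h3, map_add,
        map_smul, hcT (j - 1) (by omega)]
  have h1 : i + 1 < k := h1
  rw [indG_apply_of_gt hi _ h1]
  rcases lt_trichotomy k j with h2 | rfl | h2
  · rw [indT_apply_of_lt _ h2, indT_apply_of_lt _ h2, indG_apply_of_gt hi _ h1]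
    exact e (h.g_t_comm _ _ (by omega) (by omega) (by omega) (by omega)) _
  · rw [indT_apply_self, indT_apply_self, indG_apply_of_gt hi _ h1]
    exact e (hτ.comm_g _ (by omega)) _
  · rw [indT_apply_of_gt _ h2, indT_apply_of_gt _ h2, indG_apply_of_gt hi _ h1]
    exact e (h.g_t_comm _ _ (by omega) (by omega) (by omega) (by omega)) _

/-- Induction from `n` to `n + 1` strands. -/
theorem Family.induced [NeZero d] (h : Family d n u G T) (hτ : Framing d n G T τ) :
    Family d (n + 1) u (indG d n u G T τ) (indT n T τ) where
  g_comm i j hj hij := indG_comm h hτ (by omega) hij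
  braid i hi := indG_braid h hτ (by omega)
  t_comm i j hi hj := by
    rw [indT, indT, ← map_mul, ← map_mul]
    exact congrArg _ (funext fun k => indTEntry_comm h hτ hi hj k)
  t_pow i hi := by
    rw [indT, ← map_pow, ← map_one (diagonalEnd (n + 1) N)]
    exact congrArg _ (funext fun k => indTEntry_pow h hτ hi k)
  g_t_left i hi := indG_indT_left h hτ (by omega)
  g_t_right i hi := indG_indT_right h hτ (by omega)
  g_t_comm i j hi hj h1 h2 := indG_indT_comm h hτ (by omega) hj h1 h2
  quadratic i hi := indG_quadratic h hτ (by omega)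

theorem indT_diagonalEnd {c : Module.End ℂ N} (hT : ∀ i, i < n → c * T i = T i * c)
    (hc : c * τ = τ * c) {i : ℕ} (hi : i < n + 1) (v : Fin (n + 1) → N) :
    indT n T τ i (diagonalEnd (n + 1) N (fun _ => c) v)
      = diagonalEnd (n + 1) N (fun _ => c) (indT n T τ i v) := by
  refine funext fun k => ?_
  have : c * indTEntry n T τ i k = indTEntry n T τ i k * c := by
    unfold indTEntry
    split_ifs
    · exact hT _ (by omega)
    · exact hc
    · exact hT _ (by omega)
  exact (LinearMap.congr_fun this (v k)).symm

/-- With `c` a right multiplication, this and the preceding lemma turn the induced module into a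
bimodule. -/
theorem indG_diagonalEnd {c : Module.End ℂ N} (hG : ∀ i, i + 1 < n → c * G i = G i * c)
    (hT : ∀ i, i < n → c * T i = T i * c) (hc : c * τ = τ * c) {i : ℕ} (hi : i < n)
    (v : Fin (n + 1) → N) :
    indG d n u G T τ i (diagonalEnd (n + 1) N (fun _ => c) v)
      = diagonalEnd (n + 1) N (fun _ => c) (indG d n u G T τ i v) := by
  have hp : ∀ w, c (framingAverage d 0 (T i) τ w) = framingAverage d 0 (T i) τ (c w) :=
    fun w => LinearMap.congr_fun (mul_framingAverage 0 (hT i hi) hc) w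
  refine funext fun k => ?_
  obtain ⟨k, hk⟩ := k
  rw [diagonalEnd_apply]
  rcases lt_or_ge k i with h1 | h1
  · simp only [indG_apply_of_lt hi _ h1, diagonalEnd_apply]
    exact (LinearMap.congr_fun (hG (i - 1) (by omega)) _).symm
  rcases h1.eq_or_lt with rfl | h1
  · simp only [indG_apply_self hi, diagonalEnd_apply, map_add, map_smul, hp]
  rcases (Nat.succ_le_of_lt h1).eq_or_lt with h1 | h1
  · obtain rfl : k = i + 1 := h1.symm
    simp only [indG_apply_succ hi, diagonalEnd_apply, map_add, map_smul, hp]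
  have h1 : i + 1 < k := h1
  simp only [indG_apply_of_gt hi _ h1, diagonalEnd_apply]
  exact (LinearMap.congr_fun (hG i (by omega)) _).symm

end Induced

/-! ### Ascending products of braid generators -/

section Run

variable {d n : ℕ} {u : ℂ} {A : Type*} [Ring A] [Algebra ℂ A] {G T : ℕ → A}

/-- The product `G_k G_{k+1} ⋯ G_{k+m-1}`. -/
def run (G : ℕ → A) : ℕ → ℕ → A
  | _, 0 => 1
  | k, m + 1 => G k * run G (k + 1) m

theorem Family.g_run_of_lt (h : Family d n u G T) {i : ℕ} (m k : ℕ) (hk : k + m < n)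
    (hi : i + 1 < k) : G i * run G k m = run G k m * G i := by
  induction m generalizing k with
  | zero => simp [run]
  | succ m ih =>
    rw [run, ← mul_assoc, h.g_comm i k (by omega) hi, mul_assoc, ih (k + 1) (by omega) (by omega),
      mul_assoc]

/-- The factors before `G i` commute with `G (i+1)`, the braid relation turns `G (i+1)` into `G i`,
and the remaining factors commute with `G i`. -/
theorem Family.g_run (h : Family d n u G T) {i : ℕ} (m k : ℕ) (hk : k + m < n)
    (hki : k ≤ i) (hi : i + 1 < k + m) : G (i + 1) * run G k m = run G k m * G i := by
  induction m generalizing k with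
  | zero => omega
  | succ m ih =>
    rcases hki.eq_or_lt with rfl | hki
    · obtain ⟨m, rfl⟩ : ∃ m', m = m' + 1 := ⟨m - 1, by omega⟩
      rw [run, run, ← mul_assoc, ← mul_assoc, h.braid k (by omega), mul_assoc (G k * G (k + 1)),
        h.g_run_of_lt m (k + 2) (by omega) (by omega)]
      simp only [mul_assoc]
    · rw [run, ← mul_assoc, ← h.g_comm k (i + 1) (by omega) (by omega), mul_assoc,
        ih (k + 1) (by omega) (by omega) (by omega), mul_assoc]

theorem Family.t_run_of_lt (h : Family d n u G T) {i : ℕ} (m k : ℕ) (hk : k + m < n)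
    (hi : i < k) : T i * run G k m = run G k m * T i := by
  induction m generalizing k with
  | zero => simp [run]
  | succ m ih =>
    rw [run, ← mul_assoc, ← h.g_t_comm k i (by omega) (by omega) (by omega) (by omega), mul_assoc,
      ih (k + 1) (by omega) (by omega), mul_assoc]

theorem Family.t_run_left (h : Family d n u G T) (m k : ℕ) (hk : k + m < n) :
    T k * run G k m = run G k m * T (k + m) := by
  induction m generalizing k with
  | zero => simp [run]
  | succ m ih =>
    rw [run, ← mul_assoc, ← h.g_t_right k (by omega), mul_assoc, ih (k + 1) (by omega), mul_assoc]
    congr 3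
    omega

theorem Family.t_run (h : Family d n u G T) {i : ℕ} (m k : ℕ) (hk : k + m < n)
    (hki : k ≤ i) (hi : i < k + m) : T (i + 1) * run G k m = run G k m * T i := by
  induction m generalizing k with
  | zero => omega
  | succ m ih =>
    rcases hki.eq_or_lt with rfl | hki
    · rw [run, ← mul_assoc, ← h.g_t_left k (by omega), mul_assoc,
        h.t_run_of_lt m (k + 1) (by omega) (by omega), mul_assoc]
    · rw [run, ← mul_assoc, ← h.g_t_comm k (i + 1) (by omega) (by omega) (by omega) (by omega),
        mul_assoc, ih (k + 1) (by omega) (by omega) (by omega), mul_assoc]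

end Run

/-! ### The regular representation over one strand less -/

section Representation

variable {d n : ℕ} {u : ℂ}

/-- Pointwise left multiplication on the functions `ZMod d → Y_{d,n}(u)`. -/
abbrev leftAction (d n : ℕ) (u : ℂ) : Y d n u →ₐ[ℂ] Module.End ℂ (ZMod d → Y d n u) :=
  Algebra.lsmul ℂ ℂ (ZMod d → Y d n u)

/-- Pointwise right multiplication on the functions `ZMod d → Y_{d,n}(u)`. -/
def rightMul (a : Y d n u) : Module.End ℂ (ZMod d → Y d n u) where
  toFun f j := f j * a
  map_add' f f' := by ext j; simp [add_mul]
  map_smul' c f := by ext j; simp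

/-- The shift on the functions `ZMod d → Y_{d,n}(u)`. -/
def shift (d n : ℕ) (u : ℂ) : Module.End ℂ (ZMod d → Y d n u) where
  toFun f j := f (j - 1)
  map_add' _ _ := rfl
  map_smul' _ _ := rfl

theorem shift_pow_apply (m : ℕ) (f : ZMod d → Y d n u) (j : ZMod d) :
    (shift d n u ^ m) f j = f (j - m) := by
  induction m generalizing j with
  | zero => simp
  | succ m ih =>
    rw [pow_succ', Module.End.mul_apply]
    change (shift d n u ^ m) f (j - 1) = _
    rw [ih]
    push_cast
    congr 1
    ring

theorem framing_shift [NeZero d] : Framing d n (fun i => leftAction d n u (gg i))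
    (fun i => leftAction d n u (tt i)) (shift d n u) where
  pow := by
    ext f j
    simp [shift_pow_apply]
  comm_g _ _ := rfl
  comm_t _ _ := rfl

/-- The representation of `Y_{d,n+1}(u)` by matrices over `Y_{d,n}(u)[ℤ/d]` which is the regular
representation on the cosets of `Y_{d,n}(u)`. -/
def indRep (d n : ℕ) [NeZero d] (u : ℂ) :
    Y d (n + 1) u →ₐ[ℂ] Module.End ℂ (Fin (n + 1) → ZMod d → Y d n u) :=
  (((family d n u).map (leftAction d n u)).induced framing_shift).lift

theorem indRep_gg [NeZero d] {i : ℕ} (hi : i < n) : indRep d n u (gg i)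
    = indG d n u (fun i => leftAction d n u (gg i)) (fun i => leftAction d n u (tt i))
      (shift d n u) i := by
  rw [← g_eq i (Nat.succ_lt_succ hi), indRep, Family.lift_g]

theorem indRep_tt [NeZero d] {i : ℕ} (hi : i < n + 1) : indRep d n u (tt i)
    = indT n (fun i => leftAction d n u (tt i)) (shift d n u) i := by
  rw [← t_eq i hi, indRep, Family.lift_t]

theorem rightMul_leftAction (a b : Y d n u) :
    rightMul a * leftAction d n u b = leftAction d n u b * rightMul a := by
  ext f j
  simp [rightMul, mul_assoc]

theorem rightMul_shift (a : Y d n u) : rightMul a * shift d n u = shift d n u * rightMul a := by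
  ext f j
  simp [rightMul, shift]

/-- Right multiplication on the induced module. -/
abbrev indRight (a : Y d n u) : Module.End ℂ (Fin (n + 1) → ZMod d → Y d n u) :=
  diagonalEnd (n + 1) (ZMod d → Y d n u) fun _ => rightMul a

theorem indRep_indRight [NeZero d] (y : Y d (n + 1) u) (a : Y d n u)
    (v : Fin (n + 1) → ZMod d → Y d n u) :
    indRep d n u y (indRight a v) = indRight a (indRep d n u y v) := by
  induction y using induction_mul with
  | one => simp
  | add y y' h h' => rw [map_add, LinearMap.add_apply, h, h', LinearMap.add_apply, map_add]
  | smul c y h => rw [map_smul, LinearMap.smul_apply, h, LinearMap.smul_apply, map_smul]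
  | g_mul i hi y h =>
    rw [map_mul, Module.End.mul_apply, h, Module.End.mul_apply, indRep_gg (by omega)]
    exact indG_diagonalEnd (c := rightMul a) (fun i _ => rightMul_leftAction a (gg i))
      (fun i _ => rightMul_leftAction a (tt i)) (rightMul_shift a) (by omega) _
  | t_mul i hi y h =>
    rw [map_mul, Module.End.mul_apply, h, Module.End.mul_apply, indRep_tt hi]
    exact indT_diagonalEnd (c := rightMul a) (fun i _ => rightMul_leftAction a (tt i))
      (rightMul_shift a) hi _

/-- The generator of the induced module. -/
def cyclicVector (d n : ℕ) (u : ℂ) : Fin (n + 1) → ZMod d → Y d n u :=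
  Pi.single (Fin.last n) (Pi.single 0 1)

theorem cyclicVector_of_lt {k : ℕ} (hk : k < n) :
    cyclicVector d n u ⟨k, Nat.lt_succ_of_lt hk⟩ = 0 :=
  Pi.single_eq_of_ne (fun h => hk.ne (congrArg Fin.val h)) _

theorem cyclicVector_last : cyclicVector d n u ⟨n, Nat.lt_succ_self n⟩ = Pi.single 0 1 :=
  Pi.single_eq_same _ _

/-- The generators of the smaller algebra keep the last summand and act there by left
multiplication. The cyclic vector carries `1`, for which left and right multiplication coincide.
This makes `expect` right linear. -/
theorem indRep_incl_cyclicVector [NeZero d] (a : Y d n u) :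
    indRep d n u (incl d n u a) (cyclicVector d n u) = indRight a (cyclicVector d n u) := by
  have hlast : ∀ (k : ℕ) (hk : k < n + 1), k ≠ n → cyclicVector d n u ⟨k, hk⟩ = 0 := by
    intro k hk h
    exact cyclicVector_of_lt (by omega)
  have hone : ∀ b : Y d n u, indRight b (cyclicVector d n u)
      = fun k => leftAction d n u b (cyclicVector d n u k) := by
    intro b
    ext k j
    by_cases hk : k = Fin.last n
    · subst hk
      by_cases hj : j = 0
      · subst hj; simp [cyclicVector, rightMul]
      · simp [cyclicVector, rightMul, hj]
    · simp [cyclicVector, rightMul, hk]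
  have hmul : ∀ b c : Y d n u, ∀ v : Fin (n + 1) → ZMod d → Y d n u,
      indRight (b * c) v = indRight c (indRight b v) := by
    intro b c v; ext k j; simp [rightMul, mul_assoc]
  induction a using induction_mul with
  | one => ext k j; simp [rightMul]
  | add y y' h h' =>
    rw [map_add, map_add, LinearMap.add_apply, h, h']
    ext k j
    simp [rightMul, mul_add]
  | smul c y h =>
    rw [map_smul, map_smul, LinearMap.smul_apply, h]
    ext k j
    simp [rightMul]
  | g_mul i hi y h =>
    rw [map_mul, map_mul, Module.End.mul_apply, h, indRep_indRight, hmul, incl_gg hi,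
      indRep_gg (by omega), hone]
    congr 1
    ext1 ⟨k, hk⟩
    by_cases hkn : k = n
    · subst hkn
      rw [indG_apply_of_gt (by omega) _ hi]
    · simp only [hlast k hk hkn, map_zero]
      have h0 := hlast i (by omega) (by omega)
      have h1 := hlast (i + 1) (by omega) (by omega)
      rcases lt_trichotomy k i with h2 | rfl | h2
      · rw [indG_apply_of_lt (by omega) _ h2, hlast k hk hkn, map_zero]
      · rw [indG_apply_self (by omega), h0, h1, map_zero, smul_zero, add_zero]
      · rcases (Nat.succ_le_of_lt h2).eq_or_lt with h3 | h3
        · obtain rfl : k = i + 1 := h3.symm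
          rw [indG_apply_succ (by omega), h0, map_zero, smul_zero, add_zero]
        · rw [indG_apply_of_gt (by omega) _ h3, hlast k hk hkn, map_zero]
  | t_mul i hi y h =>
    rw [map_mul, map_mul, Module.End.mul_apply, h, indRep_indRight, hmul, incl_tt hi,
      indRep_tt (by omega), hone]
    congr 1
    ext1 ⟨k, hk⟩
    by_cases hkn : k = n
    · subst hkn
      rw [indT_apply_of_gt _ hi]
    · simp only [indT, diagonalEnd_apply, hlast k hk hkn, map_zero]

end Representation

/-! ### The conditional expectation -/

section Expectation

variable {d n : ℕ} [NeZero d] {u : ℂ}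

/-- `f ↦ ∑_j g_k ⋯ g_{n-2} t_{n-1}^j f_j`. -/
def closeStrand (d n : ℕ) [NeZero d] (u : ℂ) (k : ℕ) : (ZMod d → Y d n u) →ₗ[ℂ] Y d n u where
  toFun f := run gg k (n - 1 - k) * ∑ j, tt (n - 1) ^ j.val * f j
  map_add' f f' := by simp [mul_add, Finset.sum_add_distrib]
  map_smul' c f := by simp [← Finset.smul_sum]

theorem closeStrand_apply (k : ℕ) (f : ZMod d → Y d n u) :
    closeStrand d n u k f = run gg k (n - 1 - k) * ∑ j, tt (n - 1) ^ j.val * f j := rfl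

/-- Closing the strand turns the shift into multiplication by `t_{n-1}`, and `t_k` travels along
`g_k ⋯ g_{n-2}` to become `t_{n-1}`. -/
theorem closeStrand_shift {k : ℕ} (hk : k < n) (f : ZMod d → Y d n u) :
    closeStrand d n u k (shift d n u f) = tt k * closeStrand d n u k f := by
  have hp : (tt (n - 1) : Y d n u) ^ d = 1 := (family d n u).t_pow _ (by omega)
  have h1 := (family d n u).t_run_left (n - 1 - k) k (by omega)
  rw [show k + (n - 1 - k) = n - 1 by omega] at h1
  rw [closeStrand_apply, closeStrand_apply, ← mul_assoc, h1, mul_assoc,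
    Finset.mul_sum _ _ (tt (n - 1)), ← Equiv.sum_comp (Equiv.addRight (1 : ZMod d))]
  congr 1
  refine Finset.sum_congr rfl fun j _ => ?_
  have h2 : (tt (n - 1) : Y d n u) ^ (1 : ZMod d).val = tt (n - 1) := by
    simpa using pow_val_natCast hp 1
  simp only [shift, LinearMap.coe_mk, AddHom.coe_mk, Equiv.coe_addRight, add_sub_cancel_right]
  rw [add_comm, pow_val_add hp, h2, mul_assoc]

theorem closeStrand_leftAction {k : ℕ} {a b : Y d n u}
    (h1 : a * tt (n - 1) = tt (n - 1) * a)
    (h2 : b * run gg k (n - 1 - k) = run gg k (n - 1 - k) * a) (f : ZMod d → Y d n u) :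
    closeStrand d n u k (leftAction d n u a f) = b * closeStrand d n u k f := by
  rw [closeStrand_apply, closeStrand_apply, ← mul_assoc, h2, mul_assoc, Finset.mul_sum _ _ a]
  congr 1
  refine Finset.sum_congr rfl fun j _ => ?_
  have h3 : a * tt (n - 1) ^ j.val = tt (n - 1) ^ j.val * a := Commute.pow_right h1 _
  rw [← mul_assoc, h3, mul_assoc]
  rfl

theorem closeStrand_tt_of_lt {i k : ℕ} (hik : i < k) (hk : k < n) (f : ZMod d → Y d n u) :
    closeStrand d n u k (leftAction d n u (tt i) f) = tt i * closeStrand d n u k f :=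
  closeStrand_leftAction ((family d n u).t_comm _ _ (by omega) (by omega))
    ((family d n u).t_run_of_lt _ _ (by omega) hik) f

theorem closeStrand_tt_of_ge {i k : ℕ} (hik : k ≤ i) (hi : i + 1 < n) (f : ZMod d → Y d n u) :
    closeStrand d n u k (leftAction d n u (tt i) f) = tt (i + 1) * closeStrand d n u k f :=
  closeStrand_leftAction ((family d n u).t_comm _ _ (by omega) (by omega))
    ((family d n u).t_run _ _ (by omega) hik (by omega)) f

theorem closeStrand_gg_of_lt {i k : ℕ} (hik : i + 1 < k) (hk : k < n) (f : ZMod d → Y d n u) :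
    closeStrand d n u k (leftAction d n u (gg i) f) = gg i * closeStrand d n u k f :=
  closeStrand_leftAction
    ((family d n u).g_t_comm _ _ (by omega) (by omega) (by omega) (by omega))
    ((family d n u).g_run_of_lt _ _ (by omega) hik) f

theorem closeStrand_gg_of_ge {i k : ℕ} (hik : k ≤ i) (hi : i + 2 < n) (f : ZMod d → Y d n u) :
    closeStrand d n u k (leftAction d n u (gg i) f) = gg (i + 1) * closeStrand d n u k f :=
  closeStrand_leftAction
    ((family d n u).g_t_comm _ _ (by omega) (by omega) (by omega) (by omega))
    ((family d n u).g_run _ _ (by omega) hik (by omega)) f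

theorem closeStrand_succ {i : ℕ} (hi : i + 1 < n) (f : ZMod d → Y d n u) :
    gg i * closeStrand d n u (i + 1) f = closeStrand d n u i f := by
  rw [closeStrand_apply, closeStrand_apply, show n - 1 - i = (n - 1 - (i + 1)) + 1 by omega, run,
    mul_assoc]

theorem map_framingAverage_apply {d : ℕ} {N A : Type*} [AddCommGroup N] [Module ℂ N] [Ring A]
    [Algebra ℂ A] (f : N →ₗ[ℂ] A) {P Q : Module.End ℂ N} {a b : A}
    (hP : ∀ v, f (P v) = a * f v) (hQ : ∀ v, f (Q v) = b * f v) (m : ℕ) (v : N) :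
    f (framingAverage d m P Q v) = framingAverage d m a b * f v := by
  have key : ∀ {R : Module.End ℂ N} {c : A}, (∀ v, f (R v) = c * f v) →
      ∀ (s : ℕ) v, f ((R ^ s) v) = c ^ s * f v := by
    intro R c h s
    induction s with
    | zero => simp
    | succ s ih => intro v; rw [pow_succ', Module.End.mul_apply, h, ih, pow_succ', mul_assoc]
  simp only [framingAverage, LinearMap.smul_apply, LinearMap.sum_apply, Module.End.mul_apply,
    map_smul, map_sum, key hP, key hQ, smul_mul_assoc, Finset.sum_mul, mul_assoc]

/-- The functional on the induced module that defines the conditional expectation. -/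
def closeLast (d n : ℕ) [NeZero d] (u z : ℂ) (x : ZMod d → ℂ) :
    (Fin (n + 1) → ZMod d → Y d n u) →ₗ[ℂ] Y d n u :=
  (∑ j, x j • (LinearMap.proj j ∘ₗ LinearMap.proj (Fin.last n)))
    + z • ∑ k : Fin n, closeStrand d n u k ∘ₗ LinearMap.proj k.castSucc

theorem closeLast_apply (z : ℂ) (x : ZMod d → ℂ) (v : Fin (n + 1) → ZMod d → Y d n u) :
    closeLast d n u z x v = ∑ j, x j • v ⟨n, Nat.lt_succ_self n⟩ j
      + z • ∑ k : Fin n, closeStrand d n u k (v ⟨k, Nat.lt_succ_of_lt k.2⟩) := by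
  simp [closeLast, Fin.last, Fin.castSucc, Fin.castAdd, Fin.castLE]

theorem closeLast_indRight (z : ℂ) (x : ZMod d → ℂ) (a : Y d n u)
    (v : Fin (n + 1) → ZMod d → Y d n u) :
    closeLast d n u z x (indRight a v) = closeLast d n u z x v * a := by
  simp [closeLast_apply, closeStrand_apply, rightMul, add_mul, Finset.sum_mul, Finset.mul_sum,
    mul_assoc]

/-- Left linearity of the closure. The components `i` and `i+1` must be treated together: since
`closeStrand` at `i` is `g_i` times `closeStrand` at `i+1`, their sum is the quadratic relation for
`g_i`. -/
theorem closeLast_gg (z : ℂ) (x : ZMod d → ℂ) {i : ℕ} (hi : i + 1 < n)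
    (v : Fin (n + 1) → ZMod d → Y d n u) :
    closeLast d n u z x (indRep d n u (gg i) v) = gg i * closeLast d n u z x v := by
  have hin : i < n := by omega
  rw [indRep_gg hin, closeLast_apply, closeLast_apply, mul_add]
  congr 1
  · rw [indG_apply_of_gt hin _ hi, Finset.mul_sum]
    exact Finset.sum_congr rfl fun j _ => (mul_smul_comm _ _ _).symm
  rw [mul_smul_comm, Finset.mul_sum]
  congr 1
  -- In the difference of the two sums, every term outside the components `i` and `i+1` vanishes by
  -- itself.
  rw [← sub_eq_zero, ← Finset.sum_sub_distrib,
    Fintype.sum_eq_add (⟨i, hin⟩ : Fin n) ⟨i + 1, hi⟩ (by simp)]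
  · simp only [indG_apply_self hin, indG_apply_succ hin, map_add, map_smul]
    have h1 : ∀ f, closeStrand d n u i (framingAverage d 0 (leftAction d n u (tt i))
        (shift d n u) f) = framingAverage d 0 (tt i) (tt (i + 1)) * closeStrand d n u i f := by
      intro f
      rw [map_framingAverage_apply _ (closeStrand_tt_of_ge le_rfl hi) (closeStrand_shift hin),
        framingAverage_comm ((family d n u).t_pow _ hi) ((family d n u).t_pow _ hin)
          ((family d n u).t_comm _ _ hi hin)]
    have h2 : ∀ f, closeStrand d n u (i + 1) (framingAverage d 0 (leftAction d n u (tt i))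
        (shift d n u) f)
        = framingAverage d 0 (tt i) (tt (i + 1)) * closeStrand d n u (i + 1) f :=
      map_framingAverage_apply _ (closeStrand_tt_of_lt (Nat.lt_succ_self i) hi)
        (closeStrand_shift hi) 0
    rw [h1, h2, closeStrand_succ hi, ← closeStrand_succ hi (v ⟨i, _⟩), ← mul_assoc (gg i),
      (family d n u).quadratic i hi]
    simp only [add_mul, smul_mul_assoc, one_mul, mul_assoc]
    abel
  · rintro ⟨k, hk⟩ ⟨h1, h2⟩
    have h1 : k ≠ i := fun h => h1 (by simp [h])
    have h2 : k ≠ i + 1 := fun h => h2 (by simp [h])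
    rw [sub_eq_zero]
    simp only
    rcases lt_or_gt_of_ne h1 with h3 | h3
    · rw [indG_apply_of_lt hin _ h3, closeStrand_gg_of_ge (by omega) (by omega),
        Nat.sub_add_cancel (by omega)]
    · rw [indG_apply_of_gt hin _ (by omega), closeStrand_gg_of_lt (by omega) hk]

theorem closeLast_tt (z : ℂ) (x : ZMod d → ℂ) {i : ℕ} (hi : i < n)
    (v : Fin (n + 1) → ZMod d → Y d n u) :
    closeLast d n u z x (indRep d n u (tt i) v) = tt i * closeLast d n u z x v := by
  rw [indRep_tt (by omega), closeLast_apply, closeLast_apply, mul_add]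
  congr 1
  · rw [indT_apply_of_gt _ hi, Finset.mul_sum]
    exact Finset.sum_congr rfl fun j _ => (mul_smul_comm _ _ _).symm
  rw [mul_smul_comm, Finset.mul_sum]
  congr 1
  refine Finset.sum_congr rfl ?_
  rintro ⟨k, hk⟩ -
  simp only
  rcases lt_trichotomy k i with h3 | rfl | h3
  · rw [indT_apply_of_lt _ h3, closeStrand_tt_of_ge (by omega) (by omega),
      Nat.sub_add_cancel (by omega)]
  · rw [indT_apply_self, closeStrand_shift hk]
  · rw [indT_apply_of_gt _ h3, closeStrand_tt_of_lt h3 hk]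

theorem closeLast_incl (z : ℂ) (x : ZMod d → ℂ) (a : Y d n u)
    (v : Fin (n + 1) → ZMod d → Y d n u) :
    closeLast d n u z x (indRep d n u (incl d n u a) v) = a * closeLast d n u z x v := by
  induction a using induction_mul with
  | one => simp
  | add a b ha hb => rw [map_add, map_add, LinearMap.add_apply, map_add, ha, hb, add_mul]
  | smul c a ha => rw [map_smul, map_smul, LinearMap.smul_apply, map_smul, ha, smul_mul_assoc]
  | g_mul i hi a ha =>
    rw [map_mul, map_mul, Module.End.mul_apply, incl_gg hi, closeLast_gg z x hi, ha, mul_assoc]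
  | t_mul i hi a ha =>
    rw [map_mul, map_mul, Module.End.mul_apply, incl_tt hi, closeLast_tt z x hi, ha, mul_assoc]

/-- The conditional expectation `Y_{d,n+1}(u) → Y_{d,n}(u)` with parameters `z` and `x`. -/
def expect (d n : ℕ) [NeZero d] (u z : ℂ) (x : ZMod d → ℂ) : Y d (n + 1) u →ₗ[ℂ] Y d n u where
  toFun y := closeLast d n u z x (indRep d n u y (cyclicVector d n u))
  map_add' y y' := by simp
  map_smul' c y := by simp

theorem expect_apply (z : ℂ) (x : ZMod d → ℂ) (y : Y d (n + 1) u) :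
    expect d n u z x y = closeLast d n u z x (indRep d n u y (cyclicVector d n u)) := rfl

theorem expect_mul_incl (z : ℂ) (x : ZMod d → ℂ) (y : Y d (n + 1) u) (a : Y d n u) :
    expect d n u z x (y * incl d n u a) = expect d n u z x y * a := by
  rw [expect_apply, map_mul, Module.End.mul_apply, indRep_incl_cyclicVector, indRep_indRight,
    closeLast_indRight, expect_apply]

theorem expect_incl_mul (z : ℂ) (x : ZMod d → ℂ) (a : Y d n u) (y : Y d (n + 1) u) :
    expect d n u z x (incl d n u a * y) = a * expect d n u z x y := by
  rw [expect_apply, map_mul, Module.End.mul_apply, closeLast_incl, expect_apply]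

theorem expect_tt_pow (z : ℂ) (x : ZMod d → ℂ) (s : ℕ) :
    expect d n u z x (tt n ^ s) = algebraMap ℂ (Y d n u) (x s) := by
  -- The framing generator acts diagonally, so the vector stays in the last summand and no term with
  -- `z` appears.
  have hT : ∀ k : ℕ, ∀ hk : k < n + 1, ∀ v : Fin (n + 1) → ZMod d → Y d n u,
      v ⟨k, hk⟩ = 0 → ∀ s : ℕ,
      (indT n (fun i => leftAction d n u (tt i)) (shift d n u) n ^ s) v ⟨k, hk⟩ = 0 := by
    intro k hk v hv s
    induction s with
    | zero => exact hv
    | succ s ih =>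
      rw [pow_succ', Module.End.mul_apply, indT, diagonalEnd_apply]
      rw [indT] at ih
      rw [ih, map_zero]
  have hL : ∀ s : ℕ, (indT n (fun i => leftAction d n u (tt i)) (shift d n u) n ^ s)
      (cyclicVector d n u) ⟨n, Nat.lt_succ_self n⟩ = (shift d n u ^ s) (Pi.single 0 1) := by
    intro s
    induction s with
    | zero => exact cyclicVector_last
    | succ s ih => rw [pow_succ', Module.End.mul_apply, indT_apply_self, ih, pow_succ']; rfl
  rw [expect_apply, map_pow, indRep_tt (Nat.lt_succ_self n), closeLast_apply, hL]
  rw [Finset.sum_eq_zero (s := (Finset.univ : Finset (Fin n))), smul_zero, add_zero,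
    Finset.sum_eq_single (s : ZMod d)]
  · rw [shift_pow_apply, sub_self, Pi.single_eq_same, Algebra.algebraMap_eq_smul_one]
  · intro j _ hj
    rw [shift_pow_apply, Pi.single_eq_of_ne (sub_ne_zero.2 hj), smul_zero]
  · simp
  · intro k _
    rw [hT _ _ _ (cyclicVector_of_lt k.2), map_zero]

theorem expect_gg (z : ℂ) (x : ZMod d → ℂ) (m : ℕ) :
    expect d (m + 1) u z x (gg m) = algebraMap ℂ (Y d (m + 1) u) z := by
  have hm : m < m + 1 := Nat.lt_succ_self m
  rw [expect_apply, indRep_gg hm, closeLast_apply, indG_apply_succ hm, cyclicVector_of_lt hm,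
    map_zero, smul_zero, add_zero, Finset.sum_eq_zero (s := (Finset.univ : Finset (ZMod d))),
    zero_add, Finset.sum_eq_single (⟨m, hm⟩ : Fin (m + 1))]
  · rw [indG_apply_self hm, cyclicVector_of_lt hm, cyclicVector_last, map_zero, smul_zero,
      add_zero, closeStrand_apply, Finset.sum_eq_single (0 : ZMod d)]
    · simp [run, Algebra.algebraMap_eq_smul_one]
    · intro j _ hj
      rw [Pi.single_eq_of_ne hj, mul_zero]
    · simp
  · rintro ⟨k, hk⟩ - h
    have hkm : k < m := lt_of_le_of_ne (by omega) fun h' => h (by simp [h'])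
    simp only
    rw [indG_apply_of_lt hm _ hkm, cyclicVector_of_lt hk, map_zero, map_zero]
  · simp
  · simp

end Expectation

/-! ### Spanning the algebra with at most one last generator -/

section Span

variable {d n m : ℕ} {u : ℂ}

theorem incl_mul_tt (a : Y d n u) : incl d n u a * tt n = tt n * incl d n u a := by
  have h := family d (n + 1) u
  induction a using induction_mul with
  | one => simp
  | add a b ha hb => rw [map_add, add_mul, ha, hb, mul_add]
  | smul c a ha => rw [map_smul, smul_mul_assoc, ha, mul_smul_comm]
  | g_mul i hi a ha =>
    rw [map_mul, incl_gg hi, mul_assoc, ha, ← mul_assoc,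
      h.g_t_comm i n (by omega) (by omega) (by omega) (by omega), mul_assoc]
  | t_mul i hi a ha =>
    rw [map_mul, incl_tt hi, mul_assoc, ha, ← mul_assoc, h.t_comm i n (by omega) (by omega),
      mul_assoc]

theorem incl_mul_tt_pow (a : Y d n u) (s : ℕ) :
    incl d n u a * tt n ^ s = tt n ^ s * incl d n u a :=
  Commute.pow_right (incl_mul_tt a) s

theorem incl_incl_mul_gg (a : Y d m u) :
    incl d (m + 1) u (incl d m u a) * gg m = gg m * incl d (m + 1) u (incl d m u a) := by
  have h := family d (m + 2) u
  induction a using induction_mul with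
  | one => simp
  | add a b ha hb => rw [map_add, map_add, add_mul, ha, hb, mul_add]
  | smul c a ha => rw [map_smul, map_smul, smul_mul_assoc, ha, mul_smul_comm]
  | g_mul i hi a ha =>
    rw [map_mul, map_mul, incl_gg hi, incl_gg (by omega), mul_assoc, ha, ← mul_assoc,
      h.g_comm i m (by omega) (by omega), mul_assoc]
  | t_mul i hi a ha =>
    rw [map_mul, map_mul, incl_tt hi, incl_tt (by omega), mul_assoc, ha, ← mul_assoc,
      ← h.g_t_comm m i (by omega) (by omega) (by omega) (by omega), mul_assoc]

theorem gg_mul_tt_pow (s : ℕ) :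
    (gg m * tt m ^ s : Y d (m + 2) u) = tt (m + 1) ^ s * gg m :=
  SemiconjBy.pow_right ((family d (m + 2) u).g_t_left m (by omega)) s

theorem gg_mul_tt_succ_pow (s : ℕ) :
    (gg m * tt (m + 1) ^ s : Y d (m + 2) u) = tt m ^ s * gg m :=
  SemiconjBy.pow_right ((family d (m + 2) u).g_t_right m (by omega)) s

/-- The elements `a g_{n-1} b` and `a t_n^s` of `Y_{d,n+1}(u)`, where `a` and `b` are in the image
of `Y_{d,n}(u)`. -/
def lastSet (d n : ℕ) (u : ℂ) : Set (Y d (n + 1) u) :=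
  {y | (∃ m, n = m + 1 ∧ ∃ a b, y = incl d n u a * gg m * incl d n u b)
    ∨ ∃ a s, y = incl d n u a * tt n ^ s}

theorem gg_mem_lastSet (a b : Y d (m + 1) u) :
    incl d (m + 1) u a * gg m * incl d (m + 1) u b ∈ lastSet d (m + 1) u :=
  Or.inl ⟨m, rfl, a, b, rfl⟩

theorem tt_mem_lastSet (a : Y d n u) (s : ℕ) : incl d n u a * tt n ^ s ∈ lastSet d n u :=
  Or.inr ⟨a, s, rfl⟩

theorem mul_mem_span_lastSet {c y : Y d (n + 1) u}
    (hc : ∀ w ∈ lastSet d n u, c * w ∈ Submodule.span ℂ (lastSet d n u))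
    (hy : y ∈ Submodule.span ℂ (lastSet d n u)) : c * y ∈ Submodule.span ℂ (lastSet d n u) := by
  induction hy using Submodule.span_induction with
  | mem w hw => exact hc w hw
  | zero => simp
  | add a b _ _ ha hb => rw [mul_add]; exact add_mem ha hb
  | smul r a _ ha => rw [mul_smul_comm]; exact Submodule.smul_mem _ _ ha

theorem incl_mul_mem_span_lastSet (a : Y d n u) {y : Y d (n + 1) u}
    (hy : y ∈ Submodule.span ℂ (lastSet d n u)) :
    incl d n u a * y ∈ Submodule.span ℂ (lastSet d n u) := by
  refine mul_mem_span_lastSet ?_ hy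
  rintro w (⟨m, rfl, b, c, rfl⟩ | ⟨b, s, rfl⟩)
  · rw [← mul_assoc, ← mul_assoc, ← map_mul]
    exact Submodule.subset_span (gg_mem_lastSet _ _)
  · rw [← mul_assoc, ← map_mul]
    exact Submodule.subset_span (tt_mem_lastSet _ _)

theorem mem_span_lastSet_mul_incl (a : Y d n u) {y : Y d (n + 1) u}
    (hy : y ∈ Submodule.span ℂ (lastSet d n u)) :
    y * incl d n u a ∈ Submodule.span ℂ (lastSet d n u) := by
  induction hy using Submodule.span_induction with
  | mem w hw =>
    rcases hw with ⟨m, rfl, b, c, rfl⟩ | ⟨b, s, rfl⟩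
    · rw [mul_assoc, ← map_mul]
      exact Submodule.subset_span (gg_mem_lastSet _ _)
    · rw [mul_assoc, ← incl_mul_tt_pow, ← mul_assoc, ← map_mul]
      exact Submodule.subset_span (tt_mem_lastSet _ _)
  | zero => simp
  | add a b _ _ ha hb => rw [add_mul]; exact add_mem ha hb
  | smul r a _ ha => rw [smul_mul_assoc]; exact Submodule.smul_mem _ _ ha

theorem tt_mul_mem_span_lastSet {y : Y d (n + 1) u}
    (hy : y ∈ Submodule.span ℂ (lastSet d n u)) :
    tt n * y ∈ Submodule.span ℂ (lastSet d n u) := by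
  refine mul_mem_span_lastSet ?_ hy
  rintro w (⟨m, rfl, b, c, rfl⟩ | ⟨b, s, rfl⟩)
  · have h1 := gg_mul_tt_pow (d := d) (m := m) (u := u) 1
    rw [pow_one, pow_one, ← incl_tt (Nat.lt_succ_self m)] at h1
    rw [← mul_assoc, ← mul_assoc, ← incl_mul_tt, mul_assoc _ (tt (m + 1)), ← h1, mul_assoc,
      mul_assoc, ← map_mul, ← mul_assoc]
    exact Submodule.subset_span (gg_mem_lastSet _ _)
  · rw [← mul_assoc, ← incl_mul_tt, mul_assoc, ← pow_succ']
    exact Submodule.subset_span (tt_mem_lastSet _ _)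

theorem tt_pow_mul_mem_span_lastSet {y : Y d (n + 1) u} (s : ℕ)
    (hy : y ∈ Submodule.span ℂ (lastSet d n u)) :
    tt n ^ s * y ∈ Submodule.span ℂ (lastSet d n u) := by
  induction s with
  | zero => simpa using hy
  | succ s ih => rw [pow_succ', mul_assoc]; exact tt_mul_mem_span_lastSet ih

theorem one_mem_span_lastSet : (1 : Y d (n + 1) u) ∈ Submodule.span ℂ (lastSet d n u) := by
  have := Submodule.subset_span (R := ℂ) (tt_mem_lastSet (1 : Y d n u) 0)
  simpa using this

theorem gg_mem_span_lastSet : (gg m : Y d (m + 2) u) ∈ Submodule.span ℂ (lastSet d (m + 1) u) := by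
  have := Submodule.subset_span (R := ℂ) (gg_mem_lastSet (1 : Y d (m + 1) u) 1)
  simpa using this

theorem gg_mul_gg_mem_span_lastSet :
    (gg m * gg m : Y d (m + 2) u) ∈ Submodule.span ℂ (lastSet d (m + 1) u) := by
  have he : ∀ y ∈ Submodule.span ℂ (lastSet d (m + 1) u),
      framingAverage d 0 (tt m) (tt (m + 1)) * y ∈ Submodule.span ℂ (lastSet d (m + 1) u) := by
    intro y hy
    rw [framingAverage, smul_mul_assoc, Finset.sum_mul]
    refine Submodule.smul_mem _ _ (Submodule.sum_mem _ fun s _ => ?_)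
    rw [mul_assoc, ← incl_tt (Nat.lt_succ_self m), ← map_pow]
    exact incl_mul_mem_span_lastSet _ (tt_pow_mul_mem_span_lastSet _ hy)
  rw [(family d (m + 2) u).quadratic m (by omega)]
  refine add_mem (add_mem one_mem_span_lastSet (Submodule.smul_mem _ _ ?_))
    (Submodule.smul_mem _ _ (he _ gg_mem_span_lastSet))
  simpa using he _ one_mem_span_lastSet

theorem span_lastSet (n : ℕ) (y : Y d (n + 1) u) : y ∈ Submodule.span ℂ (lastSet d n u) := by
  induction n with
  | zero =>
    induction y using induction_mul with
    | one => exact one_mem_span_lastSet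
    | add a b ha hb => exact add_mem ha hb
    | smul c a ha => exact Submodule.smul_mem _ _ ha
    | g_mul i hi a ha => omega
    | t_mul i hi a ha =>
      obtain rfl : i = 0 := by omega
      exact tt_mul_mem_span_lastSet ha
  | succ m ih =>
    -- Two last braid generators can be merged: decompose `a` one level down. A factor `g_{m-1}` is
    -- handled by the braid relation, a power of `t_m` by the quadratic relation.
    have key : ∀ a : Y d (m + 1) u, gg m * incl d (m + 1) u a * gg m
        ∈ Submodule.span ℂ (lastSet d (m + 1) u) := by
      intro a
      induction ih a using Submodule.span_induction with
      | mem w hw =>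
        rcases hw with ⟨l, rfl, b, c, rfl⟩ | ⟨b, s, rfl⟩
        · have hb : ∀ r : Y d (l + 3) u, gg (l + 1) *
              (incl d (l + 2) u (incl d (l + 1) u b) * r)
              = incl d (l + 2) u (incl d (l + 1) u b) * (gg (l + 1) * r) := by
            intro r; rw [← mul_assoc, ← incl_incl_mul_gg, mul_assoc]
          rw [map_mul, map_mul, mul_assoc, mul_assoc, mul_assoc, incl_incl_mul_gg, hb]
          refine incl_mul_mem_span_lastSet _ ?_
          rw [← mul_assoc, ← mul_assoc]
          refine mem_span_lastSet_mul_incl _ ?_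
          rw [incl_gg (by omega), (family d (l + 3) u).braid l (by omega)]
          rw [← incl_gg (by omega)]
          exact Submodule.subset_span (gg_mem_lastSet _ _)
        · rw [map_mul, ← mul_assoc, ← incl_incl_mul_gg, mul_assoc, mul_assoc]
          refine incl_mul_mem_span_lastSet _ ?_
          rw [map_pow, incl_tt (by omega), ← mul_assoc, gg_mul_tt_pow, mul_assoc]
          exact tt_pow_mul_mem_span_lastSet _ gg_mul_gg_mem_span_lastSet
      | zero => simp
      | add a b _ _ ha hb => rw [map_add, mul_add, add_mul]; exact add_mem ha hb
      | smul c a _ ha =>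
        rw [map_smul, mul_smul_comm, smul_mul_assoc]; exact Submodule.smul_mem _ _ ha
    induction y using induction_mul with
    | one => exact one_mem_span_lastSet
    | add a b ha hb => exact add_mem ha hb
    | smul c a ha => exact Submodule.smul_mem _ _ ha
    | g_mul i hi a ha =>
      rcases (show i ≤ m by omega).eq_or_lt with rfl | him
      · refine mul_mem_span_lastSet ?_ ha
        rintro w (⟨l, hl, b, c, rfl⟩ | ⟨b, s, rfl⟩)
        · obtain rfl : i = l := by omega
          rw [← mul_assoc, ← mul_assoc]
          exact mem_span_lastSet_mul_incl _ (key b)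
        · rw [incl_mul_tt_pow, ← mul_assoc, gg_mul_tt_succ_pow, ← incl_tt (by omega), ← map_pow]
          exact Submodule.subset_span (gg_mem_lastSet _ _)
      · rw [← incl_gg (by omega)]
        exact incl_mul_mem_span_lastSet _ ha
    | t_mul i hi a ha =>
      rcases (show i ≤ m + 1 by omega).eq_or_lt with rfl | him
      · exact tt_mul_mem_span_lastSet ha
      · rw [← incl_tt him]
        exact incl_mul_mem_span_lastSet _ ha

/-- Every element of `Y_{d,n+1}(u)` is a combination of the elements `a g_{n-1} b` and
`a t_n^s`. -/
theorem last_induction {P : Y d (n + 1) u → Prop} (zero : P 0)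
    (add : ∀ a b, P a → P b → P (a + b)) (smul : ∀ (c : ℂ) a, P a → P (c • a))
    (g_last : ∀ m, n = m + 1 → ∀ a b, P (incl d n u a * gg m * incl d n u b))
    (t_last : ∀ a s, P (incl d n u a * tt n ^ s)) (y : Y d (n + 1) u) : P y := by
  induction span_lastSet n y using Submodule.span_induction with
  | mem w hw =>
    rcases hw with ⟨m, hm, a, b, rfl⟩ | ⟨a, s, rfl⟩
    · exact g_last m hm a b
    · exact t_last a s
  | zero => exact zero
  | add a b _ _ ha hb => exact add a b ha hb
  | smul c a _ ha => exact smul c a ha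

end Span

/-! ### Construction of the Markov trace and its traciality -/

section Trace

variable {d n m : ℕ} [NeZero d] {u z : ℂ} {x : ZMod d → ℂ}

theorem tt_pow_d {d : ℕ} (hi : m < n) : (tt m : Y d n u) ^ d = 1 := (family d n u).t_pow m hi

theorem expect_tt_pow_val (j : ZMod d) :
    expect d n u z x (tt n ^ j.val) = algebraMap ℂ (Y d n u) (x j) := by
  rw [expect_tt_pow, ZMod.natCast_zmod_val]

theorem expect_gg_mul_tt_pow (s : ℕ) :
    expect d (m + 1) u z x (gg m * tt (m + 1) ^ s) = z • tt m ^ s := by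
  rw [gg_mul_tt_succ_pow, ← incl_tt (Nat.lt_succ_self m), ← map_pow, expect_incl_mul, expect_gg,
    ← Algebra.commutes, ← Algebra.smul_def]

theorem expect_tt_pow_mul_gg (s : ℕ) :
    expect d (m + 1) u z x (tt (m + 1) ^ s * gg m) = z • tt m ^ s := by
  rw [← gg_mul_tt_pow, ← incl_tt (Nat.lt_succ_self m), ← map_pow, expect_mul_incl, expect_gg,
    ← Algebra.smul_def]

/-- The value of the expectation at `g_n t_n^s g_n`. -/
def bubble (d n : ℕ) [NeZero d] (u z : ℂ) (x : ZMod d → ℂ) (s : ZMod d) : Y d (n + 1) u :=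
  x s • 1 + (u - 1) • (((1 : ℂ) / d) • ∑ r : ZMod d, x (s - r) • tt n ^ r.val)
    + (u - 1) • z • tt n ^ s.val

theorem tt_pow_mul_framingAverage (s : ZMod d) :
    (tt (m + 1) ^ s.val * framingAverage d 0 (tt m) (tt (m + 1)) : Y d (m + 2) u)
      = ((1 : ℂ) / d) • ∑ r : ZMod d, tt m ^ r.val * tt (m + 1) ^ (s - r).val := by
  have h := family d (m + 2) u
  rw [framingAverage_zero (tt_pow_d (by omega)) (tt_pow_d (by omega)), mul_smul_comm,
    Finset.mul_sum]
  congr 1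
  refine Finset.sum_congr rfl fun r _ => ?_
  have hc : Commute (tt (m + 1) : Y d (m + 2) u) (tt m) := h.t_comm _ _ (by omega) (by omega)
  rw [← mul_assoc, (hc.pow_pow _ _).eq, mul_assoc, ← pow_val_add (tt_pow_d (by omega)),
    sub_eq_add_neg]

theorem expect_tt_pow_mul_gg_mul_gg (s : ZMod d) :
    expect d (m + 1) u z x (tt (m + 1) ^ s.val * (gg m * gg m)) = bubble d m u z x s := by
  rw [(family d (m + 2) u).quadratic m (by omega), mul_add, mul_add, mul_one, mul_smul_comm,
    mul_smul_comm, ← mul_assoc, tt_pow_mul_framingAverage, bubble, map_add, map_add, map_smul,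
    map_smul, smul_mul_assoc, map_smul, map_smul, map_sum, Finset.sum_mul, map_sum,
    expect_tt_pow_val, Algebra.algebraMap_eq_smul_one]
  have h1 : ∀ r : ZMod d, expect d (m + 1) u z x (tt m ^ r.val * tt (m + 1) ^ (s - r).val)
      = x (s - r) • tt m ^ r.val := by
    intro r
    rw [← incl_tt (Nat.lt_succ_self m), ← map_pow, expect_incl_mul, expect_tt_pow_val,
      ← Algebra.commutes, ← Algebra.smul_def]
  have h2 : ∀ r : ZMod d, expect d (m + 1) u z x
      (tt m ^ r.val * tt (m + 1) ^ (s - r).val * gg m) = z • tt m ^ s.val := by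
    intro r
    rw [mul_assoc, ← incl_tt (Nat.lt_succ_self m), ← map_pow, expect_incl_mul,
      expect_tt_pow_mul_gg, mul_smul_comm, ← pow_val_add (tt_pow_d (by omega))]
    congr 3
    ring
  have hd : (d : ℂ) ≠ 0 := Nat.cast_ne_zero.2 (NeZero.ne d)
  simp only [h1, h2, Finset.sum_const, Finset.card_univ, ZMod.card]
  congr 2
  rw [← Nat.cast_smul_eq_nsmul ℂ, smul_smul, one_div, inv_mul_cancel₀ hd, one_smul]

/-- The map `a ↦ ε(g_n a g_n)` on `Y_{d,n+1}(u)`. -/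
def wrap (d n : ℕ) [NeZero d] (u z : ℂ) (x : ZMod d → ℂ) : Y d (n + 1) u →ₗ[ℂ] Y d (n + 1) u where
  toFun a := expect d (n + 1) u z x (gg n * incl d (n + 1) u a * gg n)
  map_add' a b := by simp [mul_add, add_mul]
  map_smul' c a := by simp

theorem wrap_apply (a : Y d (n + 1) u) :
    wrap d n u z x a = expect d (n + 1) u z x (gg n * incl d (n + 1) u a * gg n) := rfl

theorem wrap_incl_mul (c : Y d n u) (a : Y d (n + 1) u) :
    wrap d n u z x (incl d n u c * a) = incl d n u c * wrap d n u z x a := by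
  rw [wrap_apply, map_mul (incl d (n + 1) u), ← mul_assoc, ← incl_incl_mul_gg, mul_assoc,
    mul_assoc, expect_incl_mul, wrap_apply, mul_assoc]

theorem wrap_mul_incl (c : Y d n u) (a : Y d (n + 1) u) :
    wrap d n u z x (a * incl d n u c) = wrap d n u z x a * incl d n u c := by
  rw [wrap_apply, map_mul (incl d (n + 1) u), mul_assoc, mul_assoc, incl_incl_mul_gg, ← mul_assoc,
    ← mul_assoc, expect_mul_incl, wrap_apply]

theorem wrap_tt_pow (s : ℕ) : wrap d n u z x (tt n ^ s) = bubble d n u z x s := by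
  rw [wrap_apply, map_pow, incl_tt (Nat.lt_succ_self n), gg_mul_tt_pow, mul_assoc,
    ← expect_tt_pow_mul_gg_mul_gg, pow_val_natCast (tt_pow_d (by omega))]

/-- The braid relation leaves one last generator, between two copies of `g_m` that can be pulled out
of the expectation. -/
theorem wrap_gg : wrap d (m + 1) u z x (gg m) = z • (gg m * gg m) := by
  rw [wrap_apply, incl_gg (by omega), (family d (m + 3) u).braid m (by omega),
    ← incl_gg (show m + 1 < m + 2 by omega), mul_assoc, expect_incl_mul, expect_mul_incl,
    expect_gg, ← Algebra.smul_def, mul_smul_comm]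

/-- This is the case of `markovTrace_wrap_mul` in which both arguments contain a braid generator. -/
theorem expect_mul_commute_gg (c : Y d (m + 1) u) :
    expect d (m + 1) u z x (gg m * gg m * incl d (m + 1) u c * gg m)
      = expect d (m + 1) u z x (gg m * incl d (m + 1) u c * gg m * gg m) := by
  induction c using last_induction with
  | zero => simp
  | add a b ha hb => simp only [map_add, mul_add, add_mul, ha, hb]
  | smul r a ha => simp only [map_smul, mul_smul_comm, smul_mul_assoc, ha]
  | g_last l hl a b =>
    subst hl
    have ha : ∀ r : Y d (l + 3) u, gg (l + 1) * (incl d (l + 2) u (incl d (l + 1) u a) * r)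
        = incl d (l + 2) u (incl d (l + 1) u a) * (gg (l + 1) * r) := by
      intro r; rw [← mul_assoc, ← incl_incl_mul_gg, mul_assoc]
    have hg : incl d (l + 2) u (gg l) = gg l := incl_gg (by omega)
    have braid : ∀ r : Y d (l + 3) u, gg (l + 1) * (gg l * (gg (l + 1) * r))
        = gg l * (gg (l + 1) * (gg l * r)) := by
      intro r
      simpa only [mul_assoc] using
        congrArg (· * r) ((family d (l + 3) u).braid l (by omega))
    -- Braiding leaves a single `g_{l+1}` on each side, so both expectations become `z g_l³`.
    have key : (gg (l + 1) * (gg (l + 1) * (gg l * gg (l + 1))) : Y d (l + 3) u)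
        = gg l * (gg (l + 1) * (gg l * gg l)) := by
      have := braid 1
      rw [mul_one, mul_one] at this
      rw [this, braid]
    have key' : (gg (l + 1) * (gg l * (gg (l + 1) * gg (l + 1))) : Y d (l + 3) u)
        = gg l * (gg l * (gg (l + 1) * gg l)) := by
      have := braid 1
      rw [mul_one, mul_one] at this
      rw [braid, this]
    have e1 : expect d (l + 2) u z x (gg (l + 1) * (gg (l + 1) * (gg l * gg (l + 1))))
        = z • (gg l * (gg l * gg l)) := by
      rw [key, ← hg, ← map_mul, expect_incl_mul, expect_mul_incl, expect_gg, ← Algebra.smul_def,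
        mul_smul_comm]
    have e2 : expect d (l + 2) u z x (gg (l + 1) * (gg l * (gg (l + 1) * gg (l + 1))))
        = z • (gg l * (gg l * gg l)) := by
      rw [key', ← hg, expect_incl_mul, expect_incl_mul, expect_mul_incl, expect_gg,
        ← Algebra.smul_def, mul_smul_comm, mul_smul_comm]
    simp only [map_mul, mul_assoc, ha, incl_incl_mul_gg, expect_incl_mul, hg]
    congr 1
    have s1 : ∀ B : Y d (l + 3) u, gg (l + 1) * (gg (l + 1) * (gg l * (gg (l + 1) * B)))
        = gg (l + 1) * (gg (l + 1) * (gg l * gg (l + 1))) * B := by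
      intro B; simp only [mul_assoc]
    have s2 : ∀ B : Y d (l + 3) u, gg (l + 1) * (gg l * (gg (l + 1) * (gg (l + 1) * B)))
        = gg (l + 1) * (gg l * (gg (l + 1) * gg (l + 1))) * B := by
      intro B; simp only [mul_assoc]
    rw [s1, s2, expect_mul_incl, expect_mul_incl, e1, e2]
  | t_last a s =>
    have h := family d (m + 2) u
    have ha : ∀ r : Y d (m + 2) u, gg m * (incl d (m + 1) u (incl d m u a) * r)
        = incl d (m + 1) u (incl d m u a) * (gg m * r) := by
      intro r; rw [← mul_assoc, ← incl_incl_mul_gg, mul_assoc]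
    simp only [map_mul, map_pow, incl_tt (Nat.lt_succ_self m), mul_assoc, ha, expect_incl_mul]
    congr 1
    have c1 : (gg m * (gg m * (tt m ^ s * gg m)) : Y d (m + 2) u)
        = tt m ^ s * (gg m * gg m * gg m) := by
      rw [← mul_assoc (gg m) (tt m ^ s), gg_mul_tt_pow, mul_assoc, ← mul_assoc,
        gg_mul_tt_succ_pow]
      simp only [mul_assoc]
    have c2 : (gg m * (tt m ^ s * (gg m * gg m)) : Y d (m + 2) u)
        = tt (m + 1) ^ s * (gg m * gg m * gg m) := by
      rw [← mul_assoc, gg_mul_tt_pow]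
      simp only [mul_assoc]
    -- The two sides are `g_m³` with `t_m^s` or `t_{m+1}^s` in front. In the terms containing `e_m`
    -- these powers agree, and for the remaining term `g_m` both expectations are `z t_m^s`.
    have c3 : (tt m ^ s * framingAverage d 0 (tt m) (tt (m + 1)) : Y d (m + 2) u)
        = tt (m + 1) ^ s * framingAverage d 0 (tt m) (tt (m + 1)) := by
      have hc : (tt m * tt (m + 1) : Y d (m + 2) u) = tt (m + 1) * tt m :=
        h.t_comm _ _ (by omega) (by omega)
      have e1 : Commute (tt m : Y d (m + 2) u) (framingAverage d 0 (tt m) (tt (m + 1))) :=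
        mul_framingAverage 0 rfl hc
      have e2 : Commute (tt (m + 1) : Y d (m + 2) u) (framingAverage d 0 (tt m) (tt (m + 1))) :=
        mul_framingAverage 0 hc.symm rfl
      rw [(e1.pow_left s).eq, (e2.pow_left s).eq,
        framingAverage_mul_pow (tt_pow_d (by omega)) (tt_pow_d (by omega)) hc]
    rw [c1, c2, h.quadratic m (by omega)]
    simp only [add_mul, mul_add, one_mul, smul_mul_assoc, mul_smul_comm, ← mul_assoc, c3, map_add]
    rw [expect_tt_pow_mul_gg, ← incl_tt (Nat.lt_succ_self m), ← map_pow, expect_incl_mul,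
      expect_gg, ← Algebra.commutes, ← Algebra.smul_def]

theorem expect_bubble_mul_tt_pow (s r : ZMod d) :
    expect d n u z x (bubble d n u z x s * tt n ^ r.val)
      = algebraMap ℂ (Y d n u) (x s * x r
        + (u - 1) * (1 / d * ∑ q : ZMod d, x (s - q) * x (q + r)) + (u - 1) * (z * x (s + r))) := by
  have hp : (tt n : Y d (n + 1) u) ^ d = 1 := tt_pow_d (by omega)
  simp only [bubble, add_mul, smul_mul_assoc, one_mul, Finset.sum_mul, ← pow_val_add hp, map_add,
    map_smul, map_sum, expect_tt_pow_val, Algebra.algebraMap_eq_smul_one, mul_smul,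
    Finset.sum_smul]

theorem expect_bubble_mul_gg (s : ZMod d) :
    expect d (m + 1) u z x (bubble d (m + 1) u z x s * gg m) = z • bubble d m u z x s := by
  simp only [bubble, add_mul, smul_mul_assoc, one_mul, Finset.sum_mul, map_add,
    map_smul, map_sum, expect_tt_pow_mul_gg, expect_gg, Algebra.algebraMap_eq_smul_one, smul_add,
    Finset.smul_sum, smul_smul]
  refine congrArg₂ (· + ·) (congrArg₂ (· + ·) ?_ (Finset.sum_congr rfl fun r _ => ?_)) ?_ <;>
    congr 1 <;> ring

theorem incl_mul_bubble (a : Y d n u) (s : ZMod d) :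
    incl d n u a * bubble d n u z x s = bubble d n u z x s * incl d n u a := by
  simp only [bubble, add_mul, mul_add, smul_mul_assoc, mul_smul_comm, one_mul, mul_one,
    Finset.sum_mul, Finset.mul_sum, incl_mul_tt_pow]

/-- The Markov trace with parameters `z` and `x`. -/
def markovTrace (d : ℕ) [NeZero d] (u z : ℂ) (x : ZMod d → ℂ) : ∀ n : ℕ, Y d n u →ₗ[ℂ] ℂ
  -- Without strands there are no generators, so the values `0` and `1` play no role and every
  -- relation is vacuous.
  | 0 => (Family.lift (G := fun _ => (0 : ℂ)) (T := fun _ => (1 : ℂ)) (d := d) (n := 0) (u := u)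
      (by constructor <;> intros <;> omega)).toLinearMap
  | n + 1 => markovTrace d u z x n ∘ₗ expect d n u z x

theorem markovTrace_succ (y : Y d (n + 1) u) :
    markovTrace d u z x (n + 1) y = markovTrace d u z x n (expect d n u z x y) := rfl

theorem markovTrace_algebraMap_mul (c : ℂ) (a : Y d n u) :
    markovTrace d u z x n (algebraMap ℂ _ c * a) = c * markovTrace d u z x n a := by
  rw [← Algebra.smul_def, map_smul, smul_eq_mul]

/-- The form `(a, b) ↦ tr(ε(g_n a g_n) b)` is symmetric. -/
theorem markovTrace_wrap_mul
    (h0 : ∀ a b, markovTrace d u z x m (a * b) = markovTrace d u z x m (b * a))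
    (h1 : ∀ a b, markovTrace d u z x (m + 1) (a * b) = markovTrace d u z x (m + 1) (b * a))
    (a b : Y d (m + 1) u) :
    markovTrace d u z x (m + 1) (wrap d m u z x a * b)
      = markovTrace d u z x (m + 1) (wrap d m u z x b * a) := by
  -- The mixed case, needed in both orders: each side reduces to `z` times the trace of a product
  -- with `bubble`, and the two products differ by a cyclic rotation.
  have tg : ∀ l, m = l + 1 → ∀ (a1 b1 b2 : Y d m u) (s : ℕ),
      markovTrace d u z x (m + 1) (wrap d m u z x (incl d m u a1 * tt m ^ s)
        * (incl d m u b1 * gg l * incl d m u b2))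
      = markovTrace d u z x (m + 1) (wrap d m u z x (incl d m u b1 * gg l * incl d m u b2)
        * (incl d m u a1 * tt m ^ s)) := by
    rintro l rfl a1 b1 b2 s
    have e1 : expect d (l + 1) u z x (wrap d (l + 1) u z x (incl d (l + 1) u a1 * tt (l + 1) ^ s)
        * (incl d (l + 1) u b1 * gg l * incl d (l + 1) u b2))
        = z • (a1 * (b1 * (bubble d l u z x s * b2))) := by
      rw [wrap_incl_mul, wrap_tt_pow, mul_assoc, expect_incl_mul, ← mul_assoc, ← mul_assoc,
        ← incl_mul_bubble, mul_assoc, mul_assoc, expect_incl_mul, ← mul_assoc (bubble _ _ _ _ _ _),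
        expect_mul_incl, expect_bubble_mul_gg]
      simp only [smul_mul_assoc, mul_smul_comm]
    have e2 : expect d (l + 1) u z x (wrap d (l + 1) u z x
        (incl d (l + 1) u b1 * gg l * incl d (l + 1) u b2) * (incl d (l + 1) u a1 * tt (l + 1) ^ s))
        = z • (b1 * (bubble d l u z x s * b2) * a1) := by
      rw [wrap_mul_incl, wrap_incl_mul, wrap_gg, mul_assoc, ← mul_assoc _ _ (tt (l + 1) ^ s),
        ← map_mul, incl_mul_tt_pow, mul_assoc, expect_incl_mul, ← mul_assoc, expect_mul_incl,
        smul_mul_assoc, map_smul]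
      have : (gg l * gg l * tt (l + 1) ^ s : Y d (l + 2) u) = tt (l + 1) ^ s * (gg l * gg l) := by
        rw [mul_assoc, gg_mul_tt_succ_pow, ← mul_assoc, gg_mul_tt_pow, mul_assoc]
      rw [this, ← pow_val_natCast (tt_pow_d (by omega)) s, expect_tt_pow_mul_gg_mul_gg]
      simp only [smul_mul_assoc, mul_smul_comm, mul_assoc]
    rw [markovTrace_succ (n := l + 1), e1, markovTrace_succ (n := l + 1), e2, map_smul,
      map_smul, h0]
  induction a using last_induction with
  | zero => simp
  | add a a' ha ha' => simp only [map_add, add_mul, mul_add, ha, ha']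
  | smul c a ha => simp only [map_smul, smul_mul_assoc, mul_smul_comm, ha]
  | g_last l hl a1 a2 =>
    induction b using last_induction with
    | zero => simp
    | add b b' hb hb' => simp only [map_add, add_mul, mul_add, hb, hb']
    | smul c b hb => simp only [map_smul, smul_mul_assoc, mul_smul_comm, hb]
    | g_last l' hl' b1 b2 =>
      obtain rfl : l = l' := by omega
      subst hl
      simp only [wrap_mul_incl, wrap_incl_mul, wrap_gg, smul_mul_assoc, mul_smul_comm, map_smul]
      congr 1
      rw [h1 (incl d (l + 1) u b1 * (gg l * gg l) * incl d (l + 1) u b2)]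
      have e1 : incl d (l + 1) u a1 * (gg l * gg l) * incl d (l + 1) u a2
          * (incl d (l + 1) u b1 * gg l * incl d (l + 1) u b2)
          = incl d (l + 1) u a1 * (gg l * gg l * incl d (l + 1) u (a2 * b1) * gg l
            * incl d (l + 1) u b2) := by
        simp only [map_mul, mul_assoc]
      have e2 : incl d (l + 1) u a1 * gg l * incl d (l + 1) u a2
          * (incl d (l + 1) u b1 * (gg l * gg l) * incl d (l + 1) u b2)
          = incl d (l + 1) u a1 * (gg l * incl d (l + 1) u (a2 * b1) * gg l * gg l
            * incl d (l + 1) u b2) := by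
        simp only [map_mul, mul_assoc]
      rw [e1, e2, markovTrace_succ (n := l + 1), markovTrace_succ (n := l + 1), expect_incl_mul,
        expect_incl_mul, expect_mul_incl, expect_mul_incl, expect_mul_commute_gg]
    | t_last b1 s => exact (tg l hl b1 a1 a2 s).symm
  | t_last a1 s =>
    induction b using last_induction with
    | zero => simp
    | add b b' hb hb' => simp only [map_add, add_mul, mul_add, hb, hb']
    | smul c b hb => simp only [map_smul, smul_mul_assoc, mul_smul_comm, hb]
    | g_last l hl b1 b2 => exact tg l hl a1 b1 b2 s
    | t_last b1 r =>
      have e : ∀ (a1 b1 : Y d m u) (s r : ℕ), expect d m u z x (wrap d m u z x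
          (incl d m u a1 * tt m ^ s) * (incl d m u b1 * tt m ^ r))
          = algebraMap ℂ (Y d m u) (x s * x r
            + (u - 1) * (1 / d * ∑ q : ZMod d, x (s - q) * x (q + r))
            + (u - 1) * (z * x (s + r))) * (a1 * b1) := by
        intro a1 b1 s r
        rw [wrap_incl_mul, wrap_tt_pow, mul_assoc, expect_incl_mul, ← mul_assoc,
          ← incl_mul_bubble, mul_assoc, expect_incl_mul,
          ← pow_val_natCast (tt_pow_d (Nat.lt_succ_self m)) r, expect_bubble_mul_tt_pow,
          ← mul_assoc, Algebra.commutes]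
      rw [markovTrace_succ, markovTrace_succ, e, e, markovTrace_algebraMap_mul,
        markovTrace_algebraMap_mul, h0]
      congr 1
      -- The substitution `q ↦ -q` makes the scalar visibly symmetric in `s` and `r`.
      have hs : ∑ q : ZMod d, x (s - q) * x (q + r) = ∑ q : ZMod d, x (r - q) * x (q + s) := by
        rw [← Equiv.sum_comp (Equiv.neg (ZMod d))]
        refine Finset.sum_congr rfl fun q _ => ?_
        rw [Equiv.neg_apply, mul_comm]
        congr 2 <;> ring
      rw [hs, mul_comm (x s), add_comm (s : ZMod d)]

theorem markovTrace_last_tt (y : Y d (n + 1) u) :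
    markovTrace d u z x (n + 1) (tt n * y) = markovTrace d u z x (n + 1) (y * tt n) := by
  induction y using last_induction with
  | zero => simp
  | add a b ha hb => simp only [mul_add, add_mul, map_add, ha, hb]
  | smul c a ha => simp only [mul_smul_comm, smul_mul_assoc, map_smul, ha]
  | g_last m hm a b =>
    subst hm
    have e1 := expect_tt_pow_mul_gg (d := d) (m := m) (u := u) (z := z) (x := x) 1
    have e2 := expect_gg_mul_tt_pow (d := d) (m := m) (u := u) (z := z) (x := x) 1
    rw [pow_one] at e1 e2
    rw [mul_assoc _ _ (tt (m + 1)), incl_mul_tt b, ← mul_assoc, ← mul_assoc, ← incl_mul_tt a,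
      ← mul_assoc, mul_assoc _ (tt (m + 1)), mul_assoc _ (gg m) (tt (m + 1)),
      markovTrace_succ (n := m + 1), markovTrace_succ (n := m + 1), expect_mul_incl,
      expect_mul_incl, expect_incl_mul, expect_incl_mul, e1, e2]
  | t_last a s => rw [← mul_assoc, ← incl_mul_tt, mul_assoc, mul_assoc, ← pow_succ, ← pow_succ']

/-- For `y = a g_m b` both sides contain `g_m` twice, around `b` on one side and around `a` on the
other, so the claim is the symmetry of `markovTrace_wrap_mul`. For `y = a t^s` both expectations
have the factor `z t_m^s`. -/
theorem markovTrace_last_gg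
    (h0 : ∀ a b, markovTrace d u z x m (a * b) = markovTrace d u z x m (b * a))
    (h1 : ∀ a b, markovTrace d u z x (m + 1) (a * b) = markovTrace d u z x (m + 1) (b * a))
    (y : Y d (m + 2) u) :
    markovTrace d u z x (m + 2) (gg m * y) = markovTrace d u z x (m + 2) (y * gg m) := by
  induction y using last_induction with
  | zero => simp
  | add a b ha hb => simp only [mul_add, add_mul, map_add, ha, hb]
  | smul c a ha => simp only [mul_smul_comm, smul_mul_assoc, map_smul, ha]
  | g_last l hl a b =>
    obtain rfl : m = l := by omega
    have e : incl d (m + 1) u a * gg m * incl d (m + 1) u b * gg m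
        = incl d (m + 1) u a * (gg m * incl d (m + 1) u b * gg m) := by
      simp only [mul_assoc]
    rw [e, ← mul_assoc, ← mul_assoc, markovTrace_succ (n := m + 1), markovTrace_succ (n := m + 1),
      expect_mul_incl, expect_incl_mul, ← wrap_apply, ← wrap_apply, markovTrace_wrap_mul h0 h1, h1]
  | t_last a s =>
    rw [incl_mul_tt_pow, ← mul_assoc, ← incl_mul_tt_pow, mul_assoc _ _ (gg m),
      markovTrace_succ (n := m + 1), markovTrace_succ (n := m + 1), expect_mul_incl,
      expect_incl_mul, expect_gg_mul_tt_pow, expect_tt_pow_mul_gg, h1]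

/-- It suffices that each generator commutes under the trace. The generators of the smaller algebra
do by the bimodule property and induction. Strong induction is used because the last braid generator
needs traciality two levels down as well. -/
theorem markovTrace_mul_comm (n : ℕ) (a b : Y d n u) :
    markovTrace d u z x n (a * b) = markovTrace d u z x n (b * a) := by
  induction n using Nat.strong_induction_on with
  | _ n ih =>
    rcases n with _ | n
    · simp only [markovTrace, AlgHom.toLinearMap_apply, map_mul, mul_comm]
    have hincl : ∀ (c : Y d n u) (y : Y d (n + 1) u),
        markovTrace d u z x (n + 1) (incl d n u c * y)
          = markovTrace d u z x (n + 1) (y * incl d n u c) := by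
      intro c y
      rw [markovTrace_succ, markovTrace_succ, expect_incl_mul, expect_mul_incl,
        ih n (Nat.lt_succ_self n)]
    have step : ∀ c a b : Y d (n + 1) u, (∀ y, markovTrace d u z x (n + 1) (c * y)
        = markovTrace d u z x (n + 1) (y * c)) → (∀ y, markovTrace d u z x (n + 1) (a * y)
        = markovTrace d u z x (n + 1) (y * a)) → markovTrace d u z x (n + 1) (c * a * b)
        = markovTrace d u z x (n + 1) (b * (c * a)) := by
      intro c a b hc ha
      rw [mul_assoc, hc, mul_assoc, ha, mul_assoc]
    revert b
    induction a using induction_mul with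
    | one => simp
    | add a a' ha ha' => intro b; simp only [add_mul, mul_add, map_add, ha, ha']
    | smul c a ha => intro b; simp only [smul_mul_assoc, mul_smul_comm, map_smul, ha]
    | g_mul i hi a ha =>
      refine fun b => step _ _ _ (fun y => ?_) ha
      rcases (show i + 1 ≤ n by omega).eq_or_lt with rfl | hin
      · exact markovTrace_last_gg (fun a b => ih i (by omega) a b)
          (fun a b => ih (i + 1) (by omega) a b) y
      · rw [← incl_gg hin]
        exact hincl _ _
    | t_mul i hi a ha =>
      refine fun b => step _ _ _ (fun y => ?_) ha
      rcases (show i ≤ n by omega).eq_or_lt with rfl | hin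
      · exact markovTrace_last_tt y
      · rw [← incl_tt hin]
        exact hincl _ _

theorem markovTrace_incl (hx : x 0 = 1) (a : Y d n u) :
    markovTrace d u z x (n + 1) (incl d n u a) = markovTrace d u z x n a := by
  have := expect_tt_pow (d := d) (n := n) (u := u) z x 0
  rw [pow_zero, Nat.cast_zero, hx, map_one (algebraMap ℂ (Y d n u))] at this
  rw [markovTrace_succ, ← mul_one (incl d n u a), expect_incl_mul, this, mul_one]

theorem isMarkovTrace_markovTrace (hx : x 0 = 1) :
    IsMarkovTrace d u z x (markovTrace d u z x) where
  compat n a := markovTrace_incl hx a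
  mul_comm := markovTrace_mul_comm
  one n := by
    induction n with
    | zero => simp [markovTrace]
    | succ n ih => rw [← map_one (incl d n u), markovTrace_incl hx, ih]
  tr_g n a := by
    rw [g_eq, markovTrace_succ (n := n + 1), expect_incl_mul, expect_gg, ← Algebra.commutes,
      markovTrace_algebraMap_mul]
  tr_t n a s _ _ := by
    rw [t_eq, markovTrace_succ, expect_incl_mul, expect_tt_pow, ← Algebra.commutes,
      markovTrace_algebraMap_mul]

end Trace

/-! ### Uniqueness of the Markov trace -/

section Uniqueness

variable {d n m : ℕ} {u z : ℂ} {x : ZMod d → ℂ} {tr : ∀ n : ℕ, Y d n u →ₗ[ℂ] ℂ}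

theorem IsMarkovTrace.gg_last (h : IsMarkovTrace d u z x tr) (a b : Y d (m + 1) u) :
    tr (m + 2) (incl d (m + 1) u a * gg m * incl d (m + 1) u b) = z * tr (m + 1) (a * b) := by
  rw [h.mul_comm, ← mul_assoc, ← map_mul, ← g_eq m (Nat.lt_succ_self (m + 1)), h.tr_g, h.mul_comm]

/-- Reducing exponents mod `d` extends the rule beyond `1 ≤ s < d`; the residue `0` is covered by `x
0 = 1` and compatibility. -/
theorem IsMarkovTrace.tt_last [NeZero d] (h : IsMarkovTrace d u z x tr) (hx : x 0 = 1)
    (a : Y d n u) (s : ℕ) :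
    tr (n + 1) (incl d n u a * tt n ^ s) = x s * tr n a := by
  rw [← pow_val_natCast (tt_pow_d (Nat.lt_succ_self n)) s]
  by_cases hs : (s : ZMod d) = 0
  · rw [hs, hx, ZMod.val_zero, pow_zero, mul_one, one_mul, h.compat]
  · have := h.tr_t n a (s : ZMod d).val (Nat.one_le_iff_ne_zero.2 fun h0 =>
      hs ((ZMod.val_eq_zero _).1 h0)) (ZMod.val_lt _)
    rw [t_eq, ZMod.natCast_zmod_val] at this
    exact this

theorem IsMarkovTrace.unique [NeZero d] {tr' : ∀ n : ℕ, Y d n u →ₗ[ℂ] ℂ}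
    (h : IsMarkovTrace d u z x tr) (h' : IsMarkovTrace d u z x tr') (hx : x 0 = 1) : tr = tr' := by
  funext n
  refine LinearMap.ext fun y => ?_
  induction n with
  | zero =>
    induction y using induction_mul with
    | one => rw [h.one, h'.one]
    | add a b ha hb => rw [map_add, map_add, ha, hb]
    | smul c a ha => rw [map_smul, map_smul, ha]
    | g_mul i hi => omega
    | t_mul i hi => omega
  | succ n ih =>
    induction y using last_induction with
    | zero => rw [map_zero, map_zero]
    | add a b ha hb => rw [map_add, map_add, ha, hb]
    | smul c a ha => rw [map_smul, map_smul, ha]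
    | g_last m hm a b => subst hm; rw [h.gg_last, h'.gg_last, ih]
    | t_last a s => rw [h.tt_last hx, h'.tt_last hx, ih]

end Uniqueness

/-! ### The ideal and its generators -/

section Quotient

variable {d n : ℕ} {u : ℂ}

theorem passesToCTL_iff (φ : Y d n u →ₗ[ℂ] ℂ) :
    PassesToCTL φ ↔ ∀ a ∈ ctlIdeal d n u, φ a = 0 := by
  constructor
  · rintro ⟨ψ, hψ⟩ a ha
    have : (ctlIdeal d n u).ringCon.mk' a = (ctlIdeal d n u).ringCon.mk' 0 :=
      (RingCon.eq _).2 ((TwoSidedIdeal.mem_iff _ _).1 ha)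
    rw [← hψ, this, hψ, map_zero]
  · intro h
    have hφ : ∀ a b, (ctlIdeal d n u).ringCon a b → φ a = φ b := by
      intro a b hab
      rw [← sub_eq_zero, ← map_sub]
      exact h _ ((TwoSidedIdeal.rel_iff _ _ _).1 hab)
    refine ⟨{ toFun := fun q => Quotient.liftOn' q φ hφ
              map_add' := ?_
              map_smul' := ?_ }, fun a => rfl⟩
    · intro q q'
      induction q using Quotient.inductionOn' with | _ a
      induction q' using Quotient.inductionOn' with | _ b
      exact map_add φ a b
    · intro c q
      induction q using Quotient.inductionOn' with | _ a
      exact map_smul φ c a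

/-- A tracial functional vanishes on a two-sided ideal once it vanishes on the left multiples of the
generators: a right factor can be rotated to the left. -/
theorem passesToCTL_iff_of_mul_comm {φ : Y d n u →ₗ[ℂ] ℂ} (hφ : ∀ a b, φ (a * b) = φ (b * a)) :
    PassesToCTL φ ↔ ∀ i (hi : i + 2 < n) a, φ (a * cElem i hi) = 0 := by
  rw [passesToCTL_iff]
  constructor
  · intro h i hi a
    exact h _ (TwoSidedIdeal.mul_mem_left _ _ _ (TwoSidedIdeal.subset_span ⟨i, hi, rfl⟩))
  · intro h a ha
    suffices ∀ b, φ (b * a) = 0 by simpa using this 1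
    induction ha using TwoSidedIdeal.span_induction with
    | mem w hw => obtain ⟨i, hi, rfl⟩ := hw; exact h i hi
    | zero => simp
    | add w w' _ _ hw hw' => intro b; rw [mul_add, map_add, hw, hw', add_zero]
    | neg w _ hw =>
      intro b
      have e : φ (b * -w) = -φ (b * w) := by rw [← map_neg]; exact congrArg φ (mul_neg b w)
      rw [e, hw, neg_zero]
    | left_absorb a w _ hw => intro b; rw [← mul_assoc, hw]
    | right_absorb b w _ hw => intro c; rw [← mul_assoc, hφ, ← mul_assoc, hw]

/-- The sum of the powers of `t_j`. -/
def framingSum (j : ℕ) : Y d n u := ∑ p ∈ Finset.range d, tt j ^ p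

/-- The product of the framing sums of three consecutive strands. -/
def framingSum₃ (i : ℕ) : Y d n u := framingSum i * framingSum (i + 1) * framingSum (i + 2)

theorem semiconj_framingSum {a : Y d n u} {i j : ℕ} (h : a * tt i = tt j * a) :
    a * framingSum i = framingSum j * a := by
  rw [framingSum, framingSum, Finset.mul_sum, Finset.sum_mul]
  exact Finset.sum_congr rfl fun p _ => SemiconjBy.pow_right h p

theorem framingSum_comm {i j : ℕ} (hi : i < n) (hj : j < n) :
    (framingSum i * framingSum j : Y d n u) = framingSum j * framingSum i :=
  semiconj_framingSum (semiconj_framingSum ((family d n u).t_comm _ _ hj hi)).symm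

theorem cElem_eq (i : ℕ) (hi : i + 2 < n) : (cElem i hi : Y d n u)
    = framingSum₃ i * (1 + gg i + gg (i + 1) + gg i * gg (i + 1) + gg (i + 1) * gg i
      + gg i * gg (i + 1) * gg i) := by
  simp only [cElem, steinberg, g_eq, t_eq, framingSum₃, framingSum, Finset.sum_mul_sum]
  simp only [Finset.sum_mul]
  exact Finset.sum_congr rfl fun p _ => Finset.sum_comm

theorem tt_mul_framingSum {j : ℕ} (hj : j < n) :
    (tt j * framingSum j : Y d n u) = framingSum j := by
  have h := mul_geom_sum (tt j : Y d n u) d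
  rw [tt_pow_d hj, sub_self, sub_mul, one_mul, sub_eq_zero] at h
  exact h

theorem framingSum_mul_tt_pow {j : ℕ} (hj : j < n) (s : ℕ) :
    (framingSum j * tt j ^ s : Y d n u) = framingSum j := by
  have h : (framingSum j * tt j : Y d n u) = framingSum j := by
    rw [← semiconj_framingSum rfl, tt_mul_framingSum hj]
  induction s with
  | zero => simp
  | succ s ih => rw [pow_succ, ← mul_assoc, ih, h]

theorem framingSum_mul_self {j : ℕ} (hj : j < n) :
    (framingSum j * framingSum j : Y d n u) = (d : ℂ) • framingSum j := by
  conv_lhs => rhs; rw [framingSum]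
  simp only [Finset.mul_sum, framingSum_mul_tt_pow hj, Finset.sum_const, Finset.card_range]
  rw [← Nat.cast_smul_eq_nsmul ℂ]

theorem gg_mul_framingSum₃ {i : ℕ} (hi : i + 2 < n) :
    (gg i * framingSum₃ i : Y d n u) = framingSum₃ i * gg i := by
  have h := family d n u
  rw [framingSum₃, ← mul_assoc, ← mul_assoc, semiconj_framingSum (h.g_t_left i (by omega)),
    mul_assoc (framingSum (i + 1)), semiconj_framingSum (h.g_t_right i (by omega)), ← mul_assoc,
    mul_assoc _ (gg i),
    semiconj_framingSum (h.g_t_comm i (i + 2) (by omega) (by omega) (by omega) (by omega)),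
    framingSum_comm (i := i + 1) (j := i) (by omega) (by omega), mul_assoc, mul_assoc, mul_assoc]

theorem gg_succ_mul_framingSum₃ {i : ℕ} (hi : i + 2 < n) :
    (gg (i + 1) * framingSum₃ i : Y d n u) = framingSum₃ i * gg (i + 1) := by
  have h := family d n u
  rw [framingSum₃, mul_assoc, ← mul_assoc, ← mul_assoc,
    semiconj_framingSum (h.g_t_comm (i + 1) i (by omega) (by omega) (by omega) (by omega)),
    mul_assoc (framingSum i), semiconj_framingSum (h.g_t_left (i + 1) (by omega)),
    mul_assoc (framingSum i), mul_assoc (framingSum (i + 2)),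
    semiconj_framingSum (h.g_t_right (i + 1) (by omega)), ← mul_assoc (framingSum (i + 2)),
    framingSum_comm (i := i + 2) (j := i + 1) (by omega) (by omega)]
  simp only [mul_assoc]

theorem tt_mul_framingSum₃ {i j : ℕ} (hi : i + 2 < n) (hij : i ≤ j) (hj : j ≤ i + 2) :
    (tt j * framingSum₃ i : Y d n u) = framingSum₃ i := by
  have h := family d n u
  have hc : ∀ k, k < n → (tt j * framingSum k : Y d n u) = framingSum k * tt j :=
    fun k hk => semiconj_framingSum (h.t_comm _ _ (by omega) hk)
  obtain rfl | rfl | rfl : j = i ∨ j = i + 1 ∨ j = i + 2 := by omega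
  · rw [framingSum₃, ← mul_assoc, ← mul_assoc, tt_mul_framingSum (by omega)]
  · rw [framingSum₃, ← mul_assoc, ← mul_assoc, hc i (by omega), mul_assoc (framingSum i),
      tt_mul_framingSum (by omega)]
  · rw [framingSum₃, ← mul_assoc, ← mul_assoc, hc i (by omega), mul_assoc (framingSum i),
      hc (i + 1) (by omega), ← mul_assoc, mul_assoc _ (tt (i + 2)), tt_mul_framingSum (by omega)]

/-- The sum factors as `(1 + a)(1 + b + b a)`, and behind `N` the relation `a² = u + (u-1) a` gives
`a (1 + a) = u (1 + a)`. No relation between `a` and `b` is involved. -/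
theorem mul_steinberg_eigenvector {A : Type*} [Ring A] [Algebra ℂ A] {N a b : A}
    (hN : ∀ r, N * (a * (a * r)) = u • (N * r) + (u - 1) • (N * (a * r))) :
    N * (a * (1 + a + b + a * b + b * a + a * b * a))
      = u • (N * (1 + a + b + a * b + b * a + a * b * a)) := by
  have h1 := hN 1
  simp only [mul_one] at h1
  simp only [mul_add, mul_one, mul_assoc, hN, h1, smul_add]
  module

theorem tt_mul_cElem {i j : ℕ} (hi : i + 2 < n) (hij : i ≤ j) (hj : j ≤ i + 2) :
    (tt j * cElem i hi : Y d n u) = cElem i hi := by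
  rw [cElem_eq, ← mul_assoc, tt_mul_framingSum₃ hi hij hj]

/-- The elements `c_{i,i+1}` are conjugate to each other. -/
theorem cElem_succ_mul_run {i : ℕ} (hi : i + 3 < n) :
    (cElem (i + 1) hi * run gg i 3 : Y d n u) = run gg i 3 * cElem i (Nat.lt_of_succ_lt hi) := by
  have h := family d n u
  have hg : ∀ j, i ≤ j → j + 1 < i + 3 → SemiconjBy (run gg i 3 : Y d n u) (gg j) (gg (j + 1)) :=
    fun j h1 h2 => (h.g_run 3 i hi h1 h2).symm
  have ht : ∀ j, i ≤ j → j < i + 3 →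
      SemiconjBy (run gg i 3 : Y d n u) (framingSum j) (framingSum (j + 1)) :=
    fun j h1 h2 => semiconj_framingSum (h.t_run 3 i hi h1 h2).symm
  have g0 := hg i le_rfl (by omega)
  have g1 := hg (i + 1) (by omega) (by omega)
  rw [cElem_eq, cElem_eq]
  refine (SemiconjBy.mul_right ?_ ?_).eq.symm
  · exact ((ht i le_rfl (by omega)).mul_right (ht (i + 1) (by omega) (by omega))).mul_right
      (ht (i + 2) (by omega) (by omega))
  · exact (((((SemiconjBy.one_right _).add_right g0).add_right g1).add_right
      (g0.mul_right g1)).add_right (g1.mul_right g0)).add_right ((g0.mul_right g1).mul_right g0)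

theorem incl_framingSum {j : ℕ} (hj : j < n) :
    incl d n u (framingSum j) = framingSum j := by
  simp only [framingSum, map_sum, map_pow, incl_tt hj]

theorem incl_cElem {i : ℕ} (hi : i + 2 < n) :
    incl d n u (cElem i hi) = cElem i (Nat.lt_succ_of_lt hi) := by
  rw [cElem_eq, cElem_eq]
  simp only [framingSum₃, map_mul, map_add, map_one, incl_framingSum hi,
    incl_framingSum (Nat.lt_of_succ_lt hi), incl_framingSum (Nat.lt_of_succ_lt
    (Nat.lt_of_succ_lt hi)), incl_gg hi, incl_gg (Nat.lt_of_succ_lt hi)]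

variable [NeZero d]

theorem framingSum_eq_sum_zmod {j : ℕ} (hj : j < n) :
    (framingSum j : Y d n u) = ∑ k : ZMod d, tt j ^ k.val := by
  rw [framingSum, ← sum_range_eq_sum_zmod]
  exact Finset.sum_congr rfl fun p _ => (pow_val_natCast (tt_pow_d hj) p).symm

theorem smul_sum_const {M : Type*} [AddCommGroup M] [Module ℂ M] (a : M) :
    ((1 : ℂ) / d) • ∑ _s ∈ Finset.range d, a = a := by
  have hd : (d : ℂ) ≠ 0 := Nat.cast_ne_zero.2 (NeZero.ne d)
  rw [Finset.sum_const, Finset.card_range, ← Nat.cast_smul_eq_nsmul ℂ, smul_smul, one_div,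
    inv_mul_cancel₀ hd, one_smul]

theorem framingSum_mul_framingSum_mul_framingAverage {i j : ℕ} (hi : i < n) (hj : j < n) :
    (framingSum i * framingSum j * framingAverage d 0 (tt i) (tt j) : Y d n u)
      = framingSum i * framingSum j := by
  rw [framingAverage, mul_smul_comm, Finset.mul_sum]
  rw [Finset.sum_congr rfl (g := fun _ => (framingSum i * framingSum j : Y d n u)), smul_sum_const]
  intro s _
  rw [← mul_assoc, framingSum_comm hi hj, mul_assoc (framingSum j), framingSum_mul_tt_pow hi,
    framingSum_comm hj hi, mul_assoc, framingSum_mul_tt_pow hj]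

theorem framingSum₃_mul_gg_mul_gg {i : ℕ} (hi : i + 2 < n) (r : Y d n u) :
    framingSum₃ i * (gg i * (gg i * r))
      = u • (framingSum₃ i * r) + (u - 1) • (framingSum₃ i * (gg i * r)) := by
  have h := family d n u
  have he : (framingSum₃ i * framingAverage d 0 (tt i) (tt (i + 1)) : Y d n u)
      = framingSum₃ i := by
    have hc : ∀ k, k < n → (framingSum (i + 2) * tt k : Y d n u) = tt k * framingSum (i + 2) :=
      fun k hk => (semiconj_framingSum (h.t_comm _ _ hk (by omega))).symm
    rw [framingSum₃, mul_assoc, mul_framingAverage 0 (hc i (by omega)) (hc (i + 1) (by omega)),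
      ← mul_assoc, framingSum_mul_framingSum_mul_framingAverage (by omega) (by omega)]
  rw [← mul_assoc (gg i), h.quadratic i (by omega)]
  simp only [add_mul, mul_add, one_mul, smul_mul_assoc, mul_smul_comm, ← mul_assoc, he]
  module

theorem framingSum₃_mul_gg_succ_mul_gg_succ {i : ℕ} (hi : i + 2 < n) (r : Y d n u) :
    framingSum₃ i * (gg (i + 1) * (gg (i + 1) * r))
      = u • (framingSum₃ i * r) + (u - 1) • (framingSum₃ i * (gg (i + 1) * r)) := by
  have h := family d n u
  have he : (framingSum₃ i * framingAverage d 0 (tt (i + 1)) (tt (i + 2)) : Y d n u)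
      = framingSum₃ i := by
    rw [framingSum₃, mul_assoc (framingSum i), mul_assoc (framingSum i),
      framingSum_mul_framingSum_mul_framingAverage (by omega) (by omega)]
  rw [← mul_assoc (gg (i + 1)), h.quadratic (i + 1) (by omega)]
  simp only [add_mul, mul_add, one_mul, smul_mul_assoc, mul_smul_comm, ← mul_assoc, he]
  module

theorem gg_mul_cElem {i : ℕ} (hi : i + 2 < n) :
    (gg i * cElem i hi : Y d n u) = u • cElem i hi := by
  rw [cElem_eq, ← mul_assoc, gg_mul_framingSum₃ hi, mul_assoc,
    mul_steinberg_eigenvector (framingSum₃_mul_gg_mul_gg hi)]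

theorem gg_succ_mul_cElem {i : ℕ} (hi : i + 2 < n) :
    (gg (i + 1) * cElem i hi : Y d n u) = u • cElem i hi := by
  -- By the braid relation the sum is symmetric in the two generators, so the eigenvector lemma
  -- applies with their roles exchanged.
  have e : (1 + gg i + gg (i + 1) + gg i * gg (i + 1) + gg (i + 1) * gg i
      + gg i * gg (i + 1) * gg i : Y d n u) = 1 + gg (i + 1) + gg i + gg (i + 1) * gg i
      + gg i * gg (i + 1) + gg (i + 1) * gg i * gg (i + 1) := by
    rw [(family d n u).braid i hi]; abel
  rw [cElem_eq, e, ← mul_assoc, gg_succ_mul_framingSum₃ hi, mul_assoc,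
    mul_steinberg_eigenvector (framingSum₃_mul_gg_succ_mul_gg_succ hi)]

/-- On three strands each generator has `c_{1,2}` as an eigenvector: braid generators with
eigenvalue `u`, framings with eigenvalue `1`. -/
theorem mul_cElem_three (a : Y d 3 u) (h : 0 + 2 < 3) :
    ∃ c : ℂ, a * cElem 0 h = c • cElem 0 h := by
  induction a using induction_mul with
  | one => exact ⟨1, by simp⟩
  | add a b ha hb =>
    obtain ⟨c, hc⟩ := ha
    obtain ⟨c', hc'⟩ := hb
    exact ⟨c + c', by rw [add_mul, hc, hc', add_smul]⟩
  | smul r a ha =>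
    obtain ⟨c, hc⟩ := ha
    exact ⟨r * c, by rw [smul_mul_assoc, hc, mul_smul]⟩
  | g_mul i hi a ha =>
    obtain ⟨c, hc⟩ := ha
    refine ⟨c * u, ?_⟩
    rw [mul_assoc, hc, mul_smul_comm, mul_smul]
    obtain rfl | rfl : i = 0 ∨ i = 1 := by omega
    · rw [gg_mul_cElem]
    · rw [gg_succ_mul_cElem (i := 0)]
  | t_mul i hi a ha =>
    obtain ⟨c, hc⟩ := ha
    exact ⟨c, by rw [mul_assoc, hc, mul_smul_comm, tt_mul_cElem h (by omega) (by omega)]⟩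

/-- The average `e` is an idempotent commuting with `g_i`, so `g_i (g_i - (u-1) e) = 1 + (u-1) e`.
This acts as `u` on the image of `e` and as `1` on its complement, with inverse `1 + (u⁻¹ - 1) e`.
-/
theorem gg_right_inverse (hu : u ≠ 0) {i : ℕ} (hi : i + 1 < n) :
    ∃ k : Y d n u, gg i * k = 1 := by
  have h := family d n u
  have hi' : i < n := by omega
  set e : Y d n u := framingAverage d 0 (tt i) (tt (i + 1)) with he
  have hc := h.t_comm i (i + 1) hi' hi
  have hee : e * e = e := by
    conv_lhs => rhs; rw [he, framingAverage]
    rw [mul_smul_comm, Finset.mul_sum, Finset.sum_congr rfl (g := fun _ => e), smul_sum_const]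
    intro s hs
    rw [zero_add, ← mul_assoc, ← framingAverage_mul_pow (tt_pow_d hi') (tt_pow_d hi) hc, mul_assoc,
      ← pow_add, Nat.add_sub_cancel' (Finset.mem_range.1 hs).le, tt_pow_d hi, mul_one]
  have hge : gg i * e = e * gg i := by
    rw [he, mul_framingAverage 0 (h.g_t_left i hi) (h.g_t_right i hi),
      framingAverage_comm (tt_pow_d hi) (tt_pow_d hi') hc.symm]
  refine ⟨(gg i - (u - 1) • e) * (1 + (u⁻¹ - 1) • e), ?_⟩
  rw [← mul_assoc, mul_sub, h.quadratic i hi, mul_smul_comm, hge, ← he, add_sub_cancel_right]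
  simp only [add_mul, mul_add, one_mul, mul_one, smul_mul_assoc, mul_smul_comm, hee]
  match_scalars
  · rfl
  · field_simp
    ring

end Quotient

/-! ### Reduction to one trace value and its computation -/

section Values

variable {d n m : ℕ} [NeZero d] {u z : ℂ} {x : ZMod d → ℂ} {tr : ∀ n : ℕ, Y d n u →ₗ[ℂ] ℂ}

/-- Since `c_{1,2}` lies in the smaller algebra, the Markov rules strip the last generator from `a`
until three strands remain, where `a` acts on it by a scalar. -/
theorem IsMarkovTrace.mul_cElem_zero (h : IsMarkovTrace d u z x tr) (hx : x 0 = 1)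
    (h3 : tr 3 (cElem 0 (by omega)) = 0) (hn : 3 ≤ n) (a : Y d n u) :
    tr n (a * cElem 0 (by omega)) = 0 := by
  induction n, hn using Nat.le_induction with
  | base =>
    obtain ⟨c, hc⟩ := mul_cElem_three a (by omega)
    rw [hc, map_smul, h3, smul_zero]
  | succ n hn ih =>
    rw [← incl_cElem (show 0 + 2 < n by omega)]
    induction a using last_induction with
    | zero => simp
    | add a b ha hb => rw [add_mul, map_add, ha, hb, add_zero]
    | smul c a ha => rw [smul_mul_assoc, map_smul, ha, smul_zero]
    | g_last m hm a b =>
      subst hm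
      rw [mul_assoc, ← map_mul, h.gg_last, ← mul_assoc, ih, mul_zero]
    | t_last a s =>
      rw [h.mul_comm, ← mul_assoc, ← map_mul, h.tt_last hx, h.mul_comm, ih, mul_zero]

theorem IsMarkovTrace.mul_cElem (h : IsMarkovTrace d u z x tr) (hx : x 0 = 1) (hu : u ≠ 0)
    (h3 : tr 3 (cElem 0 (by omega)) = 0) {i : ℕ} (hi : i + 2 < n) (a : Y d n u) :
    tr n (a * cElem i hi) = 0 := by
  induction i generalizing a with
  | zero => exact h.mul_cElem_zero hx h3 (by omega) a
  | succ i ih =>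
    -- Inserting this product and its right inverse carries the element at `i+1` to the one at `i`;
    -- cyclicity moves the leftover factors to the left.
    obtain ⟨k, hk⟩ : ∃ k : Y d n u, run gg i 3 * k = 1 := by
      obtain ⟨k0, h0⟩ := gg_right_inverse (d := d) hu (show i + 1 < n by omega)
      obtain ⟨k1, h1⟩ := gg_right_inverse (d := d) hu (show i + 1 + 1 < n by omega)
      obtain ⟨k2, h2⟩ := gg_right_inverse (d := d) hu (show i + 1 + 1 + 1 < n by omega)
      refine ⟨k2 * k1 * k0, ?_⟩
      calc run gg i 3 * (k2 * k1 * k0)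
          = gg i * (gg (i + 1) * (gg (i + 1 + 1) * k2) * k1) * k0 := by
            simp only [run, mul_one, mul_assoc]
        _ = 1 := by rw [h2, mul_one, h1, mul_one, h0]
    rw [← mul_one (cElem _ hi), ← hk, ← mul_assoc (cElem _ hi), cElem_succ_mul_run hi, ← mul_assoc,
      h.mul_comm, ← mul_assoc, ← mul_assoc, ih]

theorem IsMarkovTrace.passesToCTL_iff (h : IsMarkovTrace d u z x tr) (hx : x 0 = 1) (hu : u ≠ 0)
    (hn : 3 ≤ n) : PassesToCTL (tr n) ↔ tr 3 (cElem 0 (by omega)) = 0 := by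
  rw [passesToCTL_iff_of_mul_comm (h.mul_comm n)]
  constructor
  · intro hp
    have h0 : ∀ n (hn : 3 ≤ n), tr n (cElem 0 (by omega)) = tr 3 (cElem 0 (by omega)) := by
      intro n hn
      induction n, hn using Nat.le_induction with
      | base => rfl
      | succ n hn ih => rw [← ih, ← incl_cElem (show 0 + 2 < n by omega), h.compat]
    rw [← h0 n hn, ← one_mul (cElem _ _)]
    exact hp 0 (by omega) 1
  · intro h3 i hi a
    exact h.mul_cElem hx hu h3 hi a

theorem IsMarkovTrace.framingSum_last (h : IsMarkovTrace d u z x tr) (hx : x 0 = 1)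
    (a : Y d n u) :
    tr (n + 1) (incl d n u a * framingSum n) = (∑ k, x k) * tr n a := by
  rw [framingSum_eq_sum_zmod (Nat.lt_succ_self n), Finset.mul_sum, map_sum, Finset.sum_mul]
  refine Finset.sum_congr rfl fun k _ => ?_
  rw [h.tt_last hx, ZMod.natCast_zmod_val]

theorem IsMarkovTrace.framingSum_one (h : IsMarkovTrace d u z x tr) (hx : x 0 = 1) :
    tr 1 (framingSum 0) = ∑ k, x k := by
  have := h.framingSum_last hx (1 : Y d 0 u)
  rwa [map_one, one_mul, h.one, mul_one] at this

theorem IsMarkovTrace.framingSum_two (h : IsMarkovTrace d u z x tr) (hx : x 0 = 1) :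
    tr 2 (framingSum 0 * framingSum 1) = (∑ k, x k) ^ 2 := by
  rw [← incl_framingSum (show 0 < 1 by omega), h.framingSum_last hx, h.framingSum_one hx, pow_two]

theorem IsMarkovTrace.framingSum_two_mul_gg (h : IsMarkovTrace d u z x tr) (hx : x 0 = 1) :
    tr 2 (framingSum 0 * framingSum 1 * gg 0) = z * d * ∑ k, x k := by
  rw [mul_assoc, ← semiconj_framingSum ((family d 2 u).g_t_left 0 (by omega)), ← mul_assoc,
    ← incl_framingSum (show 0 < 1 by omega), h.gg_last, framingSum_mul_self (by omega), map_smul,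
    h.framingSum_one hx, smul_eq_mul, mul_assoc]

theorem IsMarkovTrace.framingSum_three (h : IsMarkovTrace d u z x tr) (hx : x 0 = 1) :
    tr 3 (framingSum₃ 0) = (∑ k, x k) ^ 3 := by
  rw [framingSum₃, ← incl_framingSum (show 0 < 2 by omega),
    ← incl_framingSum (show 0 + 1 < 2 by omega), ← map_mul, h.framingSum_last hx,
    h.framingSum_two hx]
  ring

/-- The value of the Markov trace at `c_{1,2}`. -/
theorem IsMarkovTrace.tr_cElem (h : IsMarkovTrace d u z x tr) (hx : x 0 = 1) :
    tr 3 (cElem 0 (by omega)) = (∑ k, x k) ^ 3 + (u + 2) * (d * z) * (∑ k, x k) ^ 2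
      + (u + 1) * (d * z) ^ 2 * ∑ k, x k := by
  set X := ∑ k, x k with hX
  set A : Y d 2 u := framingSum 0 * framingSum 1 with hA
  have hN : (framingSum₃ 0 : Y d 3 u) = incl d 2 u A * framingSum 2 := by
    rw [hA, map_mul, incl_framingSum (by omega), incl_framingSum (by omega)]
    rfl
  -- Moving the last framing sum across `g_1` doubles the sum on the middle strand. This is the
  -- source of a factor `d` accompanying `z`.
  have hAP : A * framingSum 1 = (d : ℂ) • A := by
    rw [hA, mul_assoc, framingSum_mul_self (by omega), mul_smul_comm]
  have hPA : framingSum 1 * A = (d : ℂ) • A := by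
    rw [← hAP, hA, ← mul_assoc, framingSum_comm (i := 1) (j := 0) (by omega) (by omega),
      mul_assoc]
  have hg0 : incl d 2 u (gg 0) = gg 0 := incl_gg (by omega)
  have hPg : (framingSum 2 * gg 1 : Y d 3 u) = gg 1 * incl d 2 u (framingSum 1) := by
    rw [incl_framingSum (by omega), semiconj_framingSum ((family d 3 u).g_t_left 1 (by omega))]
  have hPc : (framingSum 2 * gg 0 : Y d 3 u) = gg 0 * framingSum 2 :=
    (semiconj_framingSum
      ((family d 3 u).g_t_comm 0 2 (by omega) (by omega) (by omega) (by omega))).symm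
  have v1 : tr 3 (framingSum₃ 0 * gg 0) = X * (z * d * X) := by
    rw [hN, mul_assoc, hPc, ← hg0, ← mul_assoc, ← map_mul, h.framingSum_last hx,
      h.framingSum_two_mul_gg hx]
  have v2 : tr 3 (framingSum₃ 0 * gg 1) = z * (d * X ^ 2) := by
    rw [hN, mul_assoc, hPg, ← mul_assoc, h.gg_last, hAP, map_smul, h.framingSum_two hx,
      smul_eq_mul]
  have v3 : tr 3 (framingSum₃ 0 * (gg 0 * gg 1)) = z * (d * (z * d * X)) := by
    rw [hN, mul_assoc, ← mul_assoc (framingSum 2), hPc, mul_assoc (gg 0), hPg, ← mul_assoc,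
      ← mul_assoc, ← hg0, ← map_mul, h.gg_last, h.mul_comm, ← mul_assoc, hPA, smul_mul_assoc,
      map_smul, h.framingSum_two_mul_gg hx, smul_eq_mul]
  have v4 : tr 3 (framingSum₃ 0 * (gg 1 * gg 0)) = z * (d * (z * d * X)) := by
    rw [hN, mul_assoc, ← mul_assoc (framingSum 2), hPg, mul_assoc (gg 1), ← hg0, ← map_mul,
      ← mul_assoc, h.gg_last, ← mul_assoc, hAP, smul_mul_assoc, map_smul,
      h.framingSum_two_mul_gg hx, smul_eq_mul]
  have v5 : tr 3 (framingSum₃ 0 * (gg 0 * gg 1 * gg 0))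
      = u * (z * (d * X ^ 2)) + (u - 1) * (z * (d * (z * d * X))) := by
    -- Rotating the last `g_0` to the front creates `g_0²`, which behind the framing sums is `u +
    -- (u-1) g_0`.
    rw [← mul_assoc, h.mul_comm, ← mul_assoc, gg_mul_framingSum₃ (by omega), mul_assoc,
      framingSum₃_mul_gg_mul_gg (by omega), map_add, map_smul, map_smul, v2, v3, smul_eq_mul,
      smul_eq_mul]
  rw [cElem_eq]
  simp only [mul_add, mul_one, map_add, zero_add]
  rw [h.framingSum_three hx, v1, v2, v3, v4, v5, ← hX]
  ring

/-- Summing over the shift decouples the two indices. -/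
theorem sum_E : ∑ k, E x k = 1 / d * (∑ k, x k) ^ 2 := by
  simp only [E]
  rw [← Finset.mul_sum, Finset.sum_comm]
  congr 1
  rw [pow_two, Finset.mul_sum, ← Equiv.sum_comp (Equiv.neg (ZMod d))]
  refine Finset.sum_congr rfl fun s _ => ?_
  have hs : ∑ i, x (i + -s) = ∑ k, x k := Equiv.sum_comp (Equiv.addRight (-s)) x
  rw [← Finset.sum_mul, Equiv.neg_apply, neg_neg, hs]

/-- Summing the shifts makes the exponents on the first two strands independent, giving their full
framing sums over `d`. The middle sum then absorbs the powers of `t_1` in the second average,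
leaving the framing sum of the third strand over `d`. -/
theorem sum_e_mul_e (h01 : 0 + 1 < n) (h12 : 1 + 1 < n) :
    ∑ k : ZMod d, (e k.val 0 h01 * e 0 1 h12 : Y d n u)
      = ((1 : ℂ) / d * (1 / d)) • framingSum₃ 0 := by
  have h0 : (tt 0 : Y d n u) ^ d = 1 := tt_pow_d (by omega)
  have h1 : (tt 1 : Y d n u) ^ d = 1 := tt_pow_d (by omega)
  have h2 : (tt 2 : Y d n u) ^ d = 1 := tt_pow_d (by omega)
  have e1 : ∑ k : ZMod d, (e k.val 0 h01 : Y d n u)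
      = ((1 : ℂ) / d) • (framingSum 0 * framingSum 1) := by
    simp only [e, t_eq, zero_add]
    simp only [framingAverage_eq_sum h0 h1, ZMod.natCast_zmod_val]
    rw [← Finset.smul_sum, framingSum_eq_sum_zmod (by omega), framingSum_eq_sum_zmod (by omega),
      Finset.sum_mul_sum, Finset.sum_comm]
    rw [Finset.sum_comm (s := Finset.univ) (t := Finset.univ)
      (f := fun i j : ZMod d => (tt 0 ^ i.val * tt 1 ^ j.val : Y d n u)),
      ← Equiv.sum_comp (Equiv.neg (ZMod d))
        (fun j : ZMod d => ∑ i : ZMod d, (tt 0 ^ i.val * tt 1 ^ j.val : Y d n u))]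
    congr 1
    refine Finset.sum_congr rfl fun s _ => ?_
    rw [← Equiv.sum_comp (Equiv.addRight s)
      (fun i : ZMod d => (tt 0 ^ i.val * tt 1 ^ (Equiv.neg (ZMod d) s).val : Y d n u))]
    rfl
  rw [← Finset.sum_mul, e1, smul_mul_assoc, mul_smul]
  congr 1
  rw [e, t_eq, t_eq, framingAverage_zero h1 h2, mul_smul_comm, Finset.mul_sum]
  congr 1
  simp only [← mul_assoc]
  simp only [mul_assoc (framingSum 0) (framingSum 1), framingSum_mul_tt_pow (show 1 < n by omega)]
  rw [← Finset.mul_sum, ← Finset.mul_sum, ← mul_assoc]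
  change _ * ∑ i : ZMod d, tt 2 ^ (Equiv.neg (ZMod d) i).val = _
  rw [Equiv.sum_comp (Equiv.neg (ZMod d))
    (fun s : ZMod d => (tt 2 ^ s.val : Y d n u)), ← framingSum_eq_sum_zmod (by omega)]
  rfl

theorem IsMarkovTrace.sum_tr_e_mul_e (h : IsMarkovTrace d u z x tr) (hx : x 0 = 1) (hn : 3 ≤ n)
    (h01 : 0 + 1 < n) (h12 : 1 + 1 < n) :
    ∑ k : ZMod d, tr n (e k.val 0 h01 * e 0 1 h12)
      = 1 / d * (1 / d) * (∑ k, x k) ^ 3 := by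
  have h0 : tr n (framingSum₃ 0) = (∑ k, x k) ^ 3 := by
    clear h01 h12
    induction n, hn using Nat.le_induction with
    | base => exact h.framingSum_three hx
    | succ n hn ih =>
      rw [← ih, ← h.compat n, framingSum₃, framingSum₃, map_mul (incl d n u),
        map_mul (incl d n u), incl_framingSum (by omega), incl_framingSum (by omega),
        incl_framingSum (by omega)]
  rw [← map_sum, sum_e_mul_e, map_smul, h0, smul_eq_mul]

theorem IsMarkovTrace.passesToCTL_iff_eq (h : IsMarkovTrace d u z x tr) (hx : x 0 = 1)
    (hu : u ≠ 0) (hn : 3 ≤ n) (h01 : 0 + 1 < n) (h12 : 1 + 1 < n) :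
    PassesToCTL (tr n) ↔ (u + 1) * z ^ 2 * ∑ k, x k + (u + 2) * z * ∑ k, E x k
      + ∑ k : ZMod d, tr n (e k.val 0 h01 * e 0 1 h12) = 0 := by
  have hd : (d : ℂ) ≠ 0 := Nat.cast_ne_zero.2 (NeZero.ne d)
  rw [h.passesToCTL_iff hx hu hn, h.sum_tr_e_mul_e hx hn h01 h12, sum_E, h.tr_cElem hx]
  set X := ∑ k, x k
  -- The stated expression is the trace of `c_{1,2}` divided by `d²`.
  have : X ^ 3 + (u + 2) * (d * z) * X ^ 2 + (u + 1) * (d * z) ^ 2 * X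
      = d ^ 2 * ((u + 1) * z ^ 2 * X + (u + 2) * z * (1 / d * X ^ 2)
        + 1 / d * (1 / d) * X ^ 3) := by
    field_simp
    ring
  rw [this, mul_eq_zero_iff_left (pow_ne_zero 2 hd)]

end Values

/-! ### Parameters violating the E-condition -/

section Counterexample

variable {d : ℕ} [NeZero d]

/-- Parameters that do not satisfy the E-condition: `x_0 = 1` and `x_k = 2` otherwise. -/
def twoParam (d : ℕ) (k : ZMod d) : ℂ := if k = 0 then 1 else 2

theorem E_twoParam (m : ZMod d) :
    E (twoParam d) m = 1 / d * (4 * d - 4 + if m = 0 then 1 else 0) := by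
  -- Each factor drops from `2` to `1` at one index, `s = -m` or `s = 0`; the last term corrects the
  -- overlap of the two drops when `m = 0`.
  have e : ∀ s : ZMod d, twoParam d (m + s) * twoParam d (-s)
      = 4 - 2 * (if s = -m then 1 else 0) - 2 * (if s = 0 then 1 else 0)
        + (if s = 0 then (if m = 0 then 1 else 0) else 0) := by
    intro s
    have h1 : (m + s = 0) ↔ s = -m := by rw [add_comm, eq_neg_iff_add_eq_zero]
    simp only [twoParam, neg_eq_zero, h1]
    by_cases hs : s = 0
    · subst hs
      by_cases hm : m = 0
      · simp [hm]; norm_num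
      · have : (0 : ZMod d) ≠ -m := fun h => hm (by simpa using h.symm)
        simp [hm]; norm_num
    · by_cases hsm : s = -m
      · have hm : m ≠ 0 := fun hm => hs (by simpa [hm] using hsm)
        simp [hsm, hm]; norm_num
      · simp [hs, hsm]; norm_num
  rw [E, Finset.sum_congr rfl fun s _ => e s]
  congr 1
  simp only [Finset.sum_add_distrib, Finset.sum_sub_distrib, ← Finset.mul_sum, Finset.sum_const,
    Finset.card_univ, ZMod.card, Finset.sum_ite_eq', Finset.mem_univ, if_true, nsmul_eq_mul]
  ring

theorem not_eCondition_twoParam (hd : 2 ≤ d) : ¬ ECondition (twoParam d) := by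
  intro h
  have : Fact (1 < d) := ⟨hd⟩
  have h1 := h 1 one_ne_zero
  have hd0 : (d : ℂ) ≠ 0 := Nat.cast_ne_zero.2 (NeZero.ne d)
  rw [E_twoParam, E_twoParam, twoParam, if_neg one_ne_zero, if_neg one_ne_zero, if_pos rfl] at h1
  field_simp at h1
  -- The condition at `m = 1` reads `4d - 4 = 2 (4d - 3)`, impossible for a natural number `d`.
  have h2 : (4 * d : ℂ) = 2 := by linear_combination -h1
  have h3 : 4 * d = 2 := by exact_mod_cast h2
  omega

end Counterexample

end YokonumaHecke

end

theorem mainTheorem3 (d : ℕ) [NeZero d] (u : ℂ) (hu : u ≠ 0) (n : ℕ) (hn : 3 ≤ n) :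
    (∀ (z : ℂ) (x : ZMod d → ℂ), x 0 = 1 →
      (∃! tr : ∀ m : ℕ, YokonumaHecke.Y d m u →ₗ[ℂ] ℂ, YokonumaHecke.IsMarkovTrace d u z x tr) ∧
      ∀ tr : ∀ m : ℕ, YokonumaHecke.Y d m u →ₗ[ℂ] ℂ, YokonumaHecke.IsMarkovTrace d u z x tr →
        (YokonumaHecke.PassesToCTL (tr n) ↔
          (u + 1) * z ^ 2 * ∑ k : ZMod d, x k
            + (u + 2) * z * ∑ k : ZMod d, YokonumaHecke.E x k
            + ∑ k : ZMod d, tr n (YokonumaHecke.e k.val 0 (by omega) *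
                YokonumaHecke.e 0 1 (by omega)) = 0)) ∧
    (2 ≤ d → ∃ (z : ℂ) (x : ZMod d → ℂ) (tr : ∀ m : ℕ, YokonumaHecke.Y d m u →ₗ[ℂ] ℂ),
      x 0 = 1 ∧ YokonumaHecke.IsMarkovTrace d u z x tr ∧
        YokonumaHecke.PassesToCTL (tr n) ∧ ¬ YokonumaHecke.ECondition x) := by
  refine ⟨fun z x hx => ⟨⟨YokonumaHecke.markovTrace d u z x,
    YokonumaHecke.isMarkovTrace_markovTrace hx,
    fun tr h => h.unique (YokonumaHecke.isMarkovTrace_markovTrace hx) hx⟩,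
    fun tr h => h.passesToCTL_iff_eq hx hu hn _ _⟩, fun hd => ?_⟩
  have hd0 : (d : ℂ) ≠ 0 := Nat.cast_ne_zero.2 (NeZero.ne d)
  have hx : YokonumaHecke.twoParam d 0 = 1 := if_pos rfl
  -- The choice `z = -X/d` annihilates the factor `X + dz` of the trace of `c_{1,2}`, for every `u`.
  have hz : (d : ℂ) * (-(∑ k, YokonumaHecke.twoParam d k) / d)
      = -∑ k, YokonumaHecke.twoParam d k := mul_div_cancel₀ _ hd0
  have h := YokonumaHecke.isMarkovTrace_markovTrace (u := u)
    (z := -(∑ k, YokonumaHecke.twoParam d k) / d) hx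
  refine ⟨_, YokonumaHecke.twoParam d, _, hx, h, ?_,
    YokonumaHecke.not_eCondition_twoParam hd⟩
  rw [h.passesToCTL_iff hx hu hn, h.tr_cElem hx, hz]
  ring
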